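/- Let $S$ be a finite or countably infinite set and let $B=(B(x,y):x,y\in S)$ be a non-negative matrix that is sub-stochastic ($\sum_y B(x,y)\le 1$ for all $x$) and irreducible (for all $x,y\in S$ there is $n\ge 1$ with $B^n(x,y)>0$). Assume that (A3) there are $v\in S$ and real constants $c_1,c_2>0$ such that \[ c_1B(v,y)\le B(x,y)\le c_2B(v,y)\qquad\text{for all } x,y\in S. \] Put $\psi(y)=B(v,y)/\sum_w B(v,w)$, $\delta=c_1\sum_wB(v,w)$ and $\tilde B(x,y)=B(x,y)-\delta\psi(y)\ge 0$. Let $X=(X_n)_{n\ge0}$ be the Markov chain on $S\cup\{\Delta\}$, with $\Delta$ absorbing, that from a state $x\in S$ with probability $\delta$ draws its next state from the distribution $\psi$ (a regeneration), moves to $y\in S$ without regeneration with probability $\tilde B(x,y)$ for each $y$, and moves to $\Delta$ with probability $1-\sum_yB(x,y)$. Let $T=\inf\{n\ge0:X_n=\Delta\}$, let $\tau\ge1$ be the first time $n \geq 1$ at which $X_n$ was produced by a regeneration (with $\inf\emptyset=\infty$), let $E_x$ be expectation given $X_0=x$, and let $E_\psi=\sum_x\psi(x)E_x$. Define, in $[-\infty,\infty]$,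 \[ \theta_1=\sup\{\gamma\in\mathbb R:E_\psi e^{\gamma T}<\infty\},\qquad \theta_2=\sup\{\gamma\in\mathbb R:E_\psi e^{\gamma(T\wedge\tau)}<\infty\}. \] Then $\theta_2>\theta_1$; there is a real $\theta\ge0$ with \[ E_\psi e^{\theta\tau}I(T>\tau)=1; \] and for every real solution $\theta$ of this equation, with \[ \lambda_*=e^{-\theta},\qquad u_*(x)=E_xe^{\theta\tau}I(T>\tau),\qquad \eta_*(y)=E_\psi\sum_{j=0}^{\tau-1}e^{\theta j}I(X_j=y,\,T>j), \] the following hold. (i) $u_*$ is a positive finite-valued solution of $Bu=\lambda_*u$, and every positive finite-valued solution is a positive multiple of $u_*$. (ii) $\eta_*$ is a positive finite-valued solution of $\eta B=\lambda_*\eta$, and every positive finite-valued solution is a positive multiple of $\eta_*$. (iii) $\sum_{w\in S}\eta_*(w)u_*(w)<\infty$. (iv) If $p$ is the period of $B$, then for all $x,y\in S$, as $n\to\infty$, \[ \frac1p\sum_{j=0}^{p-1}\lambda_*^{-pn-j}B^{pn+j}(x,y)\to\frac{u_*(x)\eta_*(y)}{\sum_{w\in S}\eta_*(w)u_*(w)}.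 \] Moreover, $B$ has period one, and for all $x,y\in S$, as $n\to\infty$, \[ B^n(x,y)\sim\lambda_*^n\,\frac{u_*(x)\eta_*(y)}{\sum_{w\in S}u_*(w)\eta_*(w)}, \] where $\sim$ means that the ratio of the two sides tends to $1$. -/

import Mathlib

open MeasureTheory ProbabilityTheory Filter Topology
open scoped NNReal ENNReal

noncomputable section

namespace PerronFrobenius

/-! ### Non-negative matrices indexed by a countable set -/

/-- All row sums are at most one. -/
def IsSubstochastic {S : Type*} (B : S → S → ℝ≥0) : Prop :=
  ∀ x, ∑' y, (B x y : ℝ≥0∞) ≤ 1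

open Classical in
/-- The powers `B ^ n` of a possibly infinite matrix. -/
def matPow {S : Type*} (B : S → S → ℝ≥0) : ℕ → S → S → ℝ≥0∞
  | 0, x, y => if x = y then 1 else 0
  | n + 1, x, y => ∑' w, (B x w : ℝ≥0∞) * matPow B n w y

/-- For all `x, y` there is `n ≥ 1` with `B ^ n (x, y) > 0`. -/
def IsIrreducible {S : Type*} (B : S → S → ℝ≥0) : Prop :=
  ∀ x y, ∃ n, 1 ≤ n ∧ 0 < matPow B n x y

/-- The period of the state `x`: the gcd of all `n ≥ 1` with `B ^ n (x, x) > 0`. -/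
def period {S : Type*} (B : S → S → ℝ≥0) (x : S) : ℕ :=
  Nat.setGcd {n | 1 ≤ n ∧ 0 < matPow B n x x}

/-- Every row of `B` lies between `c₁` times and `c₂` times row `v`, where `0 < c₁`.
The infimum and the supremum over `x, y` of `B x y / B v y` are one admissible choice of `c₁`
and `c₂` (provided that the infimum is positive and the supremum finite). -/
structure RowsComparable {S : Type*} (B : S → S → ℝ≥0) (v : S) (c₁ c₂ : ℝ≥0) : Prop where
  pos : 0 < c₁
  lower : ∀ x y, c₁ * B v y ≤ B x y
  upper : ∀ x y, B x y ≤ c₂ * B v y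

/-- `ψ(y) = B(v, y) / ∑_w B(v, w)`. -/
def psi {S : Type*} (B : S → S → ℝ≥0) (v y : S) : ℝ≥0∞ :=
  B v y / ∑' w, (B v w : ℝ≥0∞)

/-- `δ = c₁ ∑_w B(v, w)`. -/
def delta {S : Type*} (B : S → S → ℝ≥0) (v : S) (c₁ : ℝ≥0) : ℝ≥0∞ :=
  c₁ * ∑' w, (B v w : ℝ≥0∞)

/-! ### The absorbed chain with randomized regenerations

The added absorbing state `Δ` is `none : Option S`. The chain carries a flag: `(y, true)` at time
`n + 1` says that the transition from time `n` to `n + 1` was made by drawing the new state from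
`ψ`. -/

/-- The transition matrix `P` on `S ∪ {Δ}`. -/
def augmented {S : Type*} (B : S → S → ℝ≥0) : Option S → Option S → ℝ≥0∞
  | some x, some y => B x y
  | some x, none => 1 - ∑' y, (B x y : ℝ≥0∞)
  | none, none => 1
  | none, some _ => 0

/-- States of the flagged chain. -/
abbrev State (S : Type*) : Type _ := Option S × Bool

instance {S : Type*} : MeasurableSpace (State S) := ⊤

instance {S : Type*} : DiscreteMeasurableSpace (State S) := ⟨fun _ => trivial⟩

/-- Transition probabilities of the flagged chain: from `x ∈ S` move to `y` by a draw from `ψ`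
with probability `δ ψ(y)`, move to `y` without such a draw with probability `B(x, y) - δ ψ(y)`,
and move to `Δ` otherwise. They do not depend on the current flag. -/
def splitStep {S : Type*} (B : S → S → ℝ≥0) (v : S) (c₁ : ℝ≥0) :
    State S → State S → ℝ≥0∞
  | (some _, _), (some y, true) => delta B v c₁ * psi B v y
  | (some x, _), (some y, false) => B x y - delta B v c₁ * psi B v y
  | (s, _), (none, false) => augmented B s none
  | (none, _), (some _, _) => 0
  | (_, _), (none, true) => 0

lemma delta_mul_psi {S : Type*} {B : S → S → ℝ≥0} (hB : IsSubstochastic B) (v : S) (c₁ : ℝ≥0)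
    (y : S) : delta B v c₁ * psi B v y = c₁ * B v y := by
  unfold delta psi
  rw [mul_assoc]
  congr 1
  refine ENNReal.mul_div_cancel' (fun h => ?_) (fun h => ?_)
  · exact ENNReal.tsum_eq_zero.1 h y
  · exact absurd (hB v) (by rw [h]; simp)

lemma augmented_tsum {S : Type*} {B : S → S → ℝ≥0} (hB : IsSubstochastic B) (s : Option S) :
    ∑' t, augmented B s t = 1 := by
  have key : ∀ f : Option S → ℝ≥0∞, ∑' t, f t = f none + ∑' y, f (some y) := by
    intro f
    rw [← (Equiv.optionEquivSumPUnit.{0} S).symm.tsum_eq, ENNReal.summable.tsum_sum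
      ENNReal.summable]
    simp [add_comm]
  rw [key]
  cases s with
  | none => simp [augmented]
  | some x => simpa [augmented] using tsub_add_cancel_of_le (hB x)

/-- Forgetting the flag, the chain moves according to `P`. -/
lemma splitStep_marginal {S : Type*} {B : S → S → ℝ≥0} (hB : IsSubstochastic B) {v : S}
    {c₁ c₂ : ℝ≥0} (h : RowsComparable B v c₁ c₂) (s : State S) (t : Option S) :
    splitStep B v c₁ s (t, true) + splitStep B v c₁ s (t, false) = augmented B s.1 t := by
  obtain ⟨s, b⟩ := s
  cases s <;> cases t
  · simp [splitStep]
  · simp [splitStep, augmented]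
  · simp [splitStep]
  · rename_i x y
    simp only [splitStep, augmented]
    apply add_tsub_cancel_of_le
    rw [delta_mul_psi hB]
    exact_mod_cast h.lower x y

/-- The transition law of the flagged chain as a probability mass function. -/
def splitPMF {S : Type*} {B : S → S → ℝ≥0} (hB : IsSubstochastic B) {v : S} {c₁ c₂ : ℝ≥0}
    (h : RowsComparable B v c₁ c₂) (s : State S) : PMF (State S) :=
  ⟨splitStep B v c₁ s, by
    have : ∑' t, splitStep B v c₁ s t = 1 := by
      rw [ENNReal.tsum_prod', ← augmented_tsum hB s.1]
      refine tsum_congr fun t => ?_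
      rw [tsum_fintype, Fintype.sum_bool, splitStep_marginal hB h]
    exact this ▸ ENNReal.summable.hasSum⟩

/-- The law on path space of the time-homogeneous Markov chain with transition law `Q` started
at `c`. -/
def chainLaw {C : Type*} [Countable C] [MeasurableSpace C] [DiscreteMeasurableSpace C]
    (Q : C → PMF C) (c : C) : Measure (ℕ → C) :=
  let K : Kernel C C := Kernel.ofFunOfCountable fun a => (Q a).toMeasure
  have : IsMarkovKernel K := ⟨fun a => PMF.toMeasure.isProbabilityMeasure (Q a)⟩
  Kernel.traj (X := fun _ => C)
    (fun n => K.comap (fun p : (Π _ : Finset.Iic n, C) => p ⟨n, Finset.mem_Iic.2 le_rfl⟩)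
      (measurable_pi_apply _)) 0 (fun _ => c)

/-- `P_x`: the law of the flagged chain started at `x ∈ S` (the initial flag plays no role). -/
def pathLaw {S : Type*} [Countable S] {B : S → S → ℝ≥0} (hB : IsSubstochastic B) {v : S}
    {c₁ c₂ : ℝ≥0} (h : RowsComparable B v c₁ c₂) (x : S) : Measure (ℕ → State S) :=
  chainLaw (splitPMF hB h) (some x, false)

/-- `E_ψ F = ∑_x ψ(x) E_x F`. -/
def expPsi {S : Type*} [Countable S] {B : S → S → ℝ≥0} (hB : IsSubstochastic B) {v : S}
    {c₁ c₂ : ℝ≥0} (h : RowsComparable B v c₁ c₂) (F : (ℕ → State S) → ℝ≥0∞) : ℝ≥0∞ :=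
  ∑' x, psi B v x * ∫⁻ ω, F ω ∂(pathLaw hB h x)

/-- `T`: the first `n ≥ 0` at which the chain is in `Δ`; `⊤` if there is none. -/
def hitT {S : Type*} (ω : ℕ → State S) : ℕ∞ := ⨅ (n : ℕ) (_ : (ω n).1 = none), (n : ℕ∞)

/-- `τ`: the first `n ≥ 1` at which the chain was drawn from `ψ`; `⊤` if there is none. -/
def regenTau {S : Type*} (ω : ℕ → State S) : ℕ∞ :=
  ⨅ (n : ℕ) (_ : 1 ≤ n ∧ (ω n).2 = true), (n : ℕ∞)

/-- `e ^ (γ N)` for a time `N` that may be infinite: `e ^ (γ ∞)` is `0`, `1`, `∞` for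
`γ < 0`, `γ = 0`, `γ > 0`. -/
def expTime (γ : ℝ) (N : ℕ∞) : ℝ≥0∞ := EReal.exp ((γ : EReal) * ((N : ℝ≥0∞) : EReal))

/-- `θ₁ = sup {γ : E_ψ e ^ (γ T) < ∞}`. -/
def theta1 {S : Type*} [Countable S] {B : S → S → ℝ≥0} (hB : IsSubstochastic B) {v : S}
    {c₁ c₂ : ℝ≥0} (h : RowsComparable B v c₁ c₂) : EReal :=
  ⨆ (γ : ℝ) (_ : expPsi hB h (fun ω => expTime γ (hitT ω)) < ∞), (γ : EReal)

/-- `θ₂ = sup {γ : E_ψ e ^ (γ (T ∧ τ)) < ∞}`. -/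
def theta2 {S : Type*} [Countable S] {B : S → S → ℝ≥0} (hB : IsSubstochastic B) {v : S}
    {c₁ c₂ : ℝ≥0} (h : RowsComparable B v c₁ c₂) : EReal :=
  ⨆ (γ : ℝ) (_ : expPsi hB h (fun ω => expTime γ (min (hitT ω) (regenTau ω))) < ∞), (γ : EReal)

open Classical in
/-- `e ^ (θ τ) I(T > τ)`. -/
def regenWeight {S : Type*} (θ : ℝ) (ω : ℕ → State S) : ℝ≥0∞ :=
  if regenTau ω < hitT ω then expTime θ (regenTau ω) else 0

open Classical in
/-- `∑_{j = 0}^{τ - 1} e ^ (θ j) I(X_j = y, T > j)`. -/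
def cycleWeight {S : Type*} (θ : ℝ) (y : S) (ω : ℕ → State S) : ℝ≥0∞ :=
  ∑' j : ℕ, if (j : ℕ∞) < regenTau ω ∧ (ω j).1 = some y ∧ (j : ℕ∞) < hitT ω
    then expTime θ j else 0

/-- `θ` solves `E_ψ e ^ (θ τ) I(T > τ) = 1`. -/
def IsRoot {S : Type*} [Countable S] {B : S → S → ℝ≥0} (hB : IsSubstochastic B) {v : S}
    {c₁ c₂ : ℝ≥0} (h : RowsComparable B v c₁ c₂) (θ : ℝ) : Prop :=
  expPsi hB h (regenWeight θ) = 1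

/-- `λ_* = e ^ (-θ)`. -/
def lamStar (θ : ℝ) : ℝ≥0∞ := ENNReal.ofReal (Real.exp (-θ))

/-- `u_*(x) = E_x e ^ (θ τ) I(T > τ)`. -/
def uStar {S : Type*} [Countable S] {B : S → S → ℝ≥0} (hB : IsSubstochastic B) {v : S}
    {c₁ c₂ : ℝ≥0} (h : RowsComparable B v c₁ c₂) (θ : ℝ) (x : S) : ℝ≥0∞ :=
  ∫⁻ ω, regenWeight θ ω ∂(pathLaw hB h x)

/-- `η_*(y) = E_ψ ∑_{j = 0}^{τ - 1} e ^ (θ j) I(X_j = y, T > j)`. -/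
def etaStar {S : Type*} [Countable S] {B : S → S → ℝ≥0} (hB : IsSubstochastic B) {v : S}
    {c₁ c₂ : ℝ≥0} (h : RowsComparable B v c₁ c₂) (θ : ℝ) (y : S) : ℝ≥0∞ :=
  expPsi hB h (cycleWeight θ y)

/-- `u` is a positive finite-valued column vector with `B u = l u`. -/
def IsPosColEigen {S : Type*} (B : S → S → ℝ≥0) (l : ℝ≥0∞) (u : S → ℝ≥0∞) : Prop :=
  (∀ x, 0 < u x ∧ u x < ∞) ∧ ∀ x, ∑' y, (B x y : ℝ≥0∞) * u y = l * u x

/-- `η` is a positive finite-valued row vector with `η B = l η`. -/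
def IsPosRowEigen {S : Type*} (B : S → S → ℝ≥0) (l : ℝ≥0∞) (η : S → ℝ≥0∞) : Prop :=
  (∀ y, 0 < η y ∧ η y < ∞) ∧ ∀ y, ∑' x, η x * (B x y : ℝ≥0∞) = l * η y

/-- `f` is a positive (finite) multiple of `g`. -/
def IsPosMultiple {S : Type*} (f g : S → ℝ≥0∞) : Prop :=
  ∃ a : ℝ≥0, 0 < a ∧ ∀ x, f x = a * g x

end PerronFrobenius

end

noncomputable section

namespace PerronFrobenius
/-! ### Action of non-negative matrices on functions -/

/-! Write `B = C + δ 1ψ`, where `C` is the residual matrix governing the chain between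
regenerations, and put `z = e^θ`. Summing over the time of the first regeneration turns `u_*` into
`U = ∑ z^(n+1) δ C^n 1` (`firstRegen`, `uStar_eq`) and `η_*` into `H = ∑ z^j ψ C^j` (`occupation`,
`etaStar_eq`). The equation for `θ` becomes `ψU = 1`, and the rest is algebra with non-negative
series.

Since `U = zCU + zδ1` and `H = ψ + zHC`, the condition `ψU = 1`, equivalently `zδ H1 = 1`, says
exactly that `zBU = U` and `zHB = H`. Iterating the same decomposition for another eigenvector shows
that it dominates a multiple of `U` or `H`; equality of a finite positive pairing then forces
equality.

The key estimate is that `ψU ≤ 1` and `B(x,y) ≤ κψ(y)` bound `U` above by a constant `K`, while `U ≥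
zδ`. Hence `zCU = U - zδ1 ≤ qU` with `q < 1`, so the series still converges somewhat beyond `z`
(`IsSplit.exists_extension`). This gives both the existence of a root (`exists_powerSeries_eq_one`)
and `θ < θ₂`. The same bounds keep `z^n ψB^n1` away from zero, so `P_ψ(T > n)` decays no faster than
`e^(-θn)` and `θ₁ ≤ θ`.

Finally `zB` dominates a multiple of the rank-one limit `UH/(HU)`. Removing that multiple leaves a
matrix that contracts geometrically, whence the powers converge (`tendsto_iterate_of_minorized`).
Irreducibility and comparability of rows make every entry of `B` positive, so the period is one. -/

/-- The action of a non-negative matrix on column vectors. -/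
def op {S : Type*} (M : S → S → ℝ≥0∞) (f : S → ℝ≥0∞) (x : S) : ℝ≥0∞ := ∑' y, M x y * f y

section Op

variable {S : Type*} (M : S → S → ℝ≥0∞)

lemma op_mono {f g : S → ℝ≥0∞} (h : f ≤ g) : op M f ≤ op M g :=
  fun _ => ENNReal.tsum_le_tsum fun y => mul_le_mul_right (h y) _

lemma op_mono_left {M N : S → S → ℝ≥0∞} (h : ∀ x y, M x y ≤ N x y) (f : S → ℝ≥0∞) :
    op M f ≤ op N f :=
  fun x => ENNReal.tsum_le_tsum fun y => mul_le_mul_left (h x y) _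

lemma op_smul (a : ℝ≥0∞) (f : S → ℝ≥0∞) : op M (a • f) = a • op M f := by
  ext x
  simp only [op, Pi.smul_apply, smul_eq_mul, ← ENNReal.tsum_mul_left]
  exact tsum_congr fun y => by ring

lemma op_add (f g : S → ℝ≥0∞) : op M (f + g) = op M f + op M g := by
  ext x
  simp only [op, Pi.add_apply, ← ENNReal.tsum_add]
  exact tsum_congr fun y => by ring

lemma op_tsum {ι : Type*} (F : ι → S → ℝ≥0∞) :
    op M (fun y => ∑' i, F i y) = fun x => ∑' i, op M (F i) x := by
  ext x
  simp only [op, ← ENNReal.tsum_mul_left]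
  exact ENNReal.tsum_comm

lemma iterate_op_mono (n : ℕ) {f g : S → ℝ≥0∞} (h : f ≤ g) :
    (op M)^[n] f ≤ (op M)^[n] g :=
  (show Monotone (op M) from fun _ _ h => op_mono M h).iterate n h

lemma iterate_op_smul (n : ℕ) (a : ℝ≥0∞) (f : S → ℝ≥0∞) :
    (op M)^[n] (a • f) = a • (op M)^[n] f := by
  induction n generalizing f with
  | zero => rfl
  | succ n ih => rw [Function.iterate_succ_apply, op_smul, ih, Function.iterate_succ_apply]

lemma iterate_op_add (n : ℕ) (f g : S → ℝ≥0∞) :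
    (op M)^[n] (f + g) = (op M)^[n] f + (op M)^[n] g := by
  induction n generalizing f g with
  | zero => rfl
  | succ n ih => simp only [Function.iterate_succ_apply, op_add, ih]

lemma iterate_op_tsum {ι : Type*} (n : ℕ) (F : ι → S → ℝ≥0∞) :
    (op M)^[n] (fun y => ∑' i, F i y) = fun x => ∑' i, (op M)^[n] (F i) x := by
  induction n generalizing F with
  | zero => rfl
  | succ n ih => simp only [Function.iterate_succ_apply, op_tsum, ih]

open Classical in
/-- The indicator of a point. -/
def point (y : S) (x : S) : ℝ≥0∞ := if x = y then 1 else 0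

lemma tsum_mul_point (f : S → ℝ≥0∞) (y : S) : ∑' x, f x * point y x = f y := by
  rw [tsum_eq_single y]
  · simp [point]
  · intro x hx
    simp [point, hx]

lemma tsum_point_mul (f : S → ℝ≥0∞) : (fun x => ∑' y, f y * point y x) = f := by
  ext x
  rw [tsum_eq_single x]
  · simp [point]
  · intro y hy
    simp [point, hy.symm]

lemma iterate_op_eq_tsum (n : ℕ) (f : S → ℝ≥0∞) (x : S) :
    (op M)^[n] f x = ∑' y, f y * (op M)^[n] (point y) x := by
  conv_lhs => rw [← tsum_point_mul f]
  rw [show (fun x => ∑' y, f y * point y x) = fun x => ∑' y, (f y • point y) x from rfl,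
    iterate_op_tsum]
  simp [iterate_op_smul]

lemma matPow_eq_iterate (B : S → S → ℝ≥0) (n : ℕ) (x y : S) :
    matPow B n x y = (op fun x y => (B x y : ℝ≥0∞))^[n] (point y) x := by
  induction n generalizing x with
  | zero => simp [matPow, point]
  | succ n ih =>
    rw [Function.iterate_succ_apply', matPow, op]
    simp only [ih]

end Op

/-! ### The Markov property on path space -/

/-- The paths that stay in `D` up to time `n`. -/
def stay {C : Type*} (D : Set C) (n : ℕ) : Set (ℕ → C) := {ω | ∀ k ≤ n, ω k ∈ D}

lemma measurableSet_stay {C : Type*} [MeasurableSpace C] [DiscreteMeasurableSpace C]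
    (D : Set C) (n : ℕ) : MeasurableSet (stay D n) := by
  have : stay D n = ⋂ k : ℕ, ⋂ _ : k ≤ n, (fun ω : ℕ → C => ω k) ⁻¹' D := by
    ext ω; simp [stay]
  rw [this]
  exact .iInter fun k => .iInter fun _ => measurable_pi_apply k (.of_discrete)

lemma mem_stay_succ {C : Type*} {D : Set C} {n : ℕ} {ω : ℕ → C} :
    ω ∈ stay D (n + 1) ↔ ω ∈ stay D n ∧ ω (n + 1) ∈ D := by
  constructor
  · exact fun h => ⟨fun k hk => h k (by omega), h _ le_rfl⟩
  · rintro ⟨h, h'⟩ k hk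
    rcases Nat.lt_or_eq_of_le hk with hk | rfl
    · exact h k (by omega)
    · exact h'

section Chain

variable {C : Type*} [Countable C] [MeasurableSpace C] [DiscreteMeasurableSpace C]

/-- This is the Markov property at time `n` on an event of the past: the joint law of the first `n +
1` coordinates and the next one is a composition-product with the transition kernel. -/
lemma lintegral_chainLaw_succ (Q : C → PMF C) (c : C) (D : Set C) (n : ℕ) (g : C → ℝ≥0∞) :
    ∫⁻ ω, (stay D n).indicator (fun ω => g (ω (n + 1))) ω ∂chainLaw Q c =
      ∫⁻ ω, (stay D n).indicator (fun ω => op (fun a b => Q a b) g (ω n)) ω ∂chainLaw Q c := by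
  unfold chainLaw
  extract_lets K hK
  set κ : (n : ℕ) → Kernel (Π _ : Finset.Iic n, C) C := fun n =>
    K.comap (fun p : (Π _ : Finset.Iic n, C) => p ⟨n, Finset.mem_Iic.2 le_rfl⟩)
      (measurable_pi_apply _) with hκ
  have key := Kernel.partialTraj_compProd_eq_map_traj (X := fun _ => C) (κ := κ)
    (Nat.zero_le n) (x₀ := fun _ => c)
  set A : Set (Π _ : Finset.Iic n, C) := {p | ∀ i, p i ∈ D} with hA
  have hAm : MeasurableSet A := by
    have : A = ⋂ i, (fun p : (Π _ : Finset.Iic n, C) => p i) ⁻¹' D := by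
      ext p; simp [hA]
    rw [this]
    exact .iInter fun i => measurable_pi_apply i (.of_discrete)
  have hmem : ∀ ω : ℕ → C, Preorder.frestrictLe (π := fun _ => C) n ω ∈ A ↔ ω ∈ stay D n := by
    intro ω
    simp [hA, stay]
  have hF : Measurable fun p : (Π _ : Finset.Iic n, C) × C => A.indicator 1 p.1 * g p.2 :=
    ((measurable_one.indicator hAm).comp measurable_fst).mul
      ((Measurable.of_discrete (f := g)).comp measurable_snd)
  have h1 : ∫⁻ ω, (stay D n).indicator (fun ω => g (ω (n + 1))) ω
        ∂Kernel.traj (X := fun _ => C) κ 0 (fun _ => c) =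
      ∫⁻ p, A.indicator 1 p.1 * g p.2 ∂((Kernel.partialTraj (X := fun _ => C) κ 0 n
        fun _ => c) ⊗ₘ κ n) := by
    rw [key, lintegral_map hF (by fun_prop)]
    refine lintegral_congr fun ω => ?_
    by_cases h : ω ∈ stay D n
    · simp [h, (hmem ω).2 h]
    · simp [h, mt (hmem ω).1 h]
  rw [h1, Measure.lintegral_compProd hF, ← Kernel.traj_map_frestrictLe_apply,
    lintegral_map (by fun_prop) (by fun_prop)]
  refine lintegral_congr fun ω => ?_
  have h2 : ∫⁻ b, g b ∂(κ n (Preorder.frestrictLe (π := fun _ => C) n ω)) =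
      op (fun a b => Q a b) g (ω n) := by
    rw [hκ, Kernel.comap_apply, lintegral_countable']
    refine tsum_congr fun b => ?_
    rw [mul_comm]
    congr 1
    exact PMF.toMeasure_apply_singleton _ _ (measurableSet_singleton b)
  by_cases h : ω ∈ stay D n
  · simp [h, (hmem ω).2 h, h2]
  · simp [h, mt (hmem ω).1 h]

lemma chainLaw_ae_zero (Q : C → PMF C) (c : C) : ∀ᵐ ω ∂chainLaw Q c, ω 0 = c := by
  unfold chainLaw
  extract_lets K hK
  set κ : (n : ℕ) → Kernel (Π _ : Finset.Iic n, C) C := fun n =>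
    K.comap (fun p : (Π _ : Finset.Iic n, C) => p ⟨n, Finset.mem_Iic.2 le_rfl⟩)
      (measurable_pi_apply _) with hκ
  have key := Kernel.traj_map_frestrictLe_apply (X := fun _ => C) (κ := κ) 0 0 (fun _ => c)
  rw [Kernel.partialTraj_self, Kernel.id_apply] at key
  have hm : MeasurableSet {p : (Π _ : Finset.Iic 0, C) | p ⟨0, by simp⟩ = c} :=
    (measurable_pi_apply (X := fun _ : Finset.Iic 0 => C) ⟨0, by simp⟩)
      (measurableSet_singleton c)
  have h : ∀ᵐ p ∂(Kernel.traj (X := fun _ => C) κ 0 (fun _ => c)).map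
      (Preorder.frestrictLe (π := fun _ => C) 0), p ⟨0, by simp⟩ = c := by
    rw [key, ae_dirac_iff hm]
  exact (ae_map_iff (by fun_prop) hm).1 h

instance (Q : C → PMF C) (c : C) : IsProbabilityMeasure (chainLaw Q c) := by
  unfold chainLaw
  infer_instance

/-- Before it leaves `D`, the chain moves according to the restriction of `Q` to `D`. -/
lemma lintegral_chainLaw_stay (Q : C → PMF C) (c : C) (D : Set C) (n : ℕ) (f : C → ℝ≥0∞) :
    ∫⁻ ω, (stay D n).indicator (fun ω => f (ω n)) ω ∂chainLaw Q c =
      D.indicator ((fun f => op (fun a b => Q a b) (D.indicator f))^[n] f) c := by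
  induction n generalizing f with
  | zero =>
    have : ∀ᵐ ω ∂chainLaw Q c, (stay D 0).indicator (fun ω => f (ω 0)) ω = D.indicator f c := by
      filter_upwards [chainLaw_ae_zero Q c] with ω hω
      have : ω ∈ stay D 0 ↔ c ∈ D := by simp [stay, hω]
      by_cases hc : c ∈ D <;> simp [this, hω, hc]
    rw [lintegral_congr_ae this]
    simp
  | succ n ih =>
    -- The last transition is peeled off, so the induction changes `f` and leaves the starting point
    -- fixed.
    rw [Function.iterate_succ_apply, ← ih, ← lintegral_chainLaw_succ]
    refine lintegral_congr fun ω => ?_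
    by_cases h : ω ∈ stay D n <;> by_cases h' : ω (n + 1) ∈ D <;>
      simp [Set.indicator, mem_stay_succ, h, h']

end Chain

/-! ### Pairings of row and column vectors -/

section Pair

variable {S : Type*}

/-- The product of a row vector and a column vector. -/
def pair (η f : S → ℝ≥0∞) : ℝ≥0∞ := ∑' x, η x * f x

lemma pair_mono (η : S → ℝ≥0∞) {f g : S → ℝ≥0∞} (h : f ≤ g) : pair η f ≤ pair η g :=
  ENNReal.tsum_le_tsum fun y => mul_le_mul_right (h y) _

lemma pair_smul (η : S → ℝ≥0∞) (a : ℝ≥0∞) (f : S → ℝ≥0∞) : pair η (a • f) = a * pair η f := by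
  simp only [pair, Pi.smul_apply, smul_eq_mul, ← ENNReal.tsum_mul_left]
  exact tsum_congr fun y => by ring

lemma pair_add (η f g : S → ℝ≥0∞) : pair η (f + g) = pair η f + pair η g := by
  simp only [pair, Pi.add_apply, ← ENNReal.tsum_add]
  exact tsum_congr fun y => by ring

lemma pair_tsum {ι : Type*} (η : S → ℝ≥0∞) (F : ι → S → ℝ≥0∞) :
    pair η (fun y => ∑' i, F i y) = ∑' i, pair η (F i) := by
  simp only [pair, ← ENNReal.tsum_mul_left]
  exact ENNReal.tsum_comm

lemma pair_one (η : S → ℝ≥0∞) : pair η 1 = ∑' x, η x := by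
  simp [pair]

lemma pair_point (η : S → ℝ≥0∞) (y : S) : pair η (point y) = η y := tsum_mul_point η y

lemma op_point (M : S → S → ℝ≥0∞) (x y : S) : op M (point y) x = M x y := tsum_mul_point _ y

lemma pair_op (η : S → ℝ≥0∞) (M : S → S → ℝ≥0∞) (f : S → ℝ≥0∞) :
    pair η (op M f) = ∑' y, (∑' x, η x * M x y) * f y := by
  simp only [pair, op, ← ENNReal.tsum_mul_left, ← ENNReal.tsum_mul_right]
  rw [ENNReal.tsum_comm]
  exact tsum_congr fun y => tsum_congr fun x => by ring

/-- Vectors that are comparable and have the same finite pairing with a positive vector agree. -/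
lemma eq_of_le_of_pair_eq {η f g : S → ℝ≥0∞} (hη : ∀ x, η x ≠ 0) (hη' : ∀ x, η x ≠ ∞)
    (h : f ≤ g) (hfg : pair η f = pair η g) (hf : pair η f ≠ ∞) : f = g := by
  by_contra hne
  obtain ⟨x, hx⟩ := Function.ne_iff.1 hne
  refine (ENNReal.tsum_lt_tsum (i := x) hf (fun y => mul_le_mul_right (h y) (η y)) ?_).ne hfg
  exact (ENNReal.mul_lt_mul_iff_right (hη x) (hη' x)).2 (lt_of_le_of_ne (h x) hx)

end Pair

/-! ### Matrices that dominate a multiple of a probability vector -/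

/-- The sub-stochastic matrix `B` is the sum of `C` and of the matrix all of whose rows are
`δ ψ`, where `ψ` is a positive probability vector, and its rows are at most `κ ψ`. -/
structure IsSplit {S : Type*} (B C : S → S → ℝ≥0∞) (ψ : S → ℝ≥0∞) (δ κ : ℝ≥0∞) : Prop where
  split : ∀ x y, B x y = C x y + δ * ψ y
  mass : pair ψ 1 = 1
  psi_ne_zero : ∀ y, ψ y ≠ 0
  delta_ne_zero : δ ≠ 0
  substoch : ∀ x, op B 1 x ≤ 1
  upper : ∀ x y, B x y ≤ κ * ψ y
  kappa_ne_top : κ ≠ ∞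

/-- `∑_{n ≥ 1} z ^ n δ C ^ (n - 1) 1`. -/
def firstRegen {S : Type*} (C : S → S → ℝ≥0∞) (δ z : ℝ≥0∞) (x : S) : ℝ≥0∞ :=
  ∑' n : ℕ, z ^ (n + 1) * δ * (op C)^[n] 1 x

/-- `∑_{j ≥ 0} z ^ j ψ C ^ j`. -/
def occupation {S : Type*} (C : S → S → ℝ≥0∞) (ψ : S → ℝ≥0∞) (z : ℝ≥0∞) (y : S) : ℝ≥0∞ :=
  ∑' j : ℕ, z ^ j * pair ψ ((op C)^[j] (point y))

/-! ### Renewal identities for the two series -/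

lemma firstRegen_eq {S : Type*} (C : S → S → ℝ≥0∞) (δ z : ℝ≥0∞) :
    firstRegen C δ z = z • op C (firstRegen C δ z) + (z * δ) • 1 := by
  have h : op C (firstRegen C δ z) = fun x => ∑' n : ℕ, z ^ (n + 1) * δ * (op C)^[n + 1] 1 x := by
    rw [show firstRegen C δ z = fun x => ∑' n : ℕ, ((z ^ (n + 1) * δ) • (op C)^[n] 1) x from rfl,
      op_tsum]
    simp only [op_smul, Function.iterate_succ_apply', Pi.smul_apply, smul_eq_mul]
  ext x
  rw [h, firstRegen, tsum_eq_zero_add' ENNReal.summable, add_comm]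
  simp only [Pi.add_apply, Pi.smul_apply, smul_eq_mul, ← ENNReal.tsum_mul_left]
  congr 1
  · exact tsum_congr fun n => by ring
  · simp

lemma pair_firstRegen {S : Type*} (C : S → S → ℝ≥0∞) (η : S → ℝ≥0∞) (δ z : ℝ≥0∞) :
    pair η (firstRegen C δ z) = ∑' n : ℕ, z ^ (n + 1) * (δ * pair η ((op C)^[n] 1)) := by
  rw [show firstRegen C δ z = fun x => ∑' n : ℕ, ((z ^ (n + 1) * δ) • (op C)^[n] 1) x from rfl,
    pair_tsum]
  simp only [pair_smul, mul_assoc]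

lemma pair_occupation {S : Type*} (C : S → S → ℝ≥0∞) (ψ : S → ℝ≥0∞) (z : ℝ≥0∞)
    (f : S → ℝ≥0∞) : pair (occupation C ψ z) f = ∑' j : ℕ, z ^ j * pair ψ ((op C)^[j] f) := by
  simp only [pair, occupation, ← ENNReal.tsum_mul_right, ← ENNReal.tsum_mul_left]
  rw [ENNReal.tsum_comm]
  refine tsum_congr fun j => ?_
  rw [ENNReal.tsum_comm]
  refine tsum_congr fun x => ?_
  rw [iterate_op_eq_tsum, ← ENNReal.tsum_mul_left, ← ENNReal.tsum_mul_left]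
  exact tsum_congr fun y => by ring

/-- The two series share their coefficients `ψC^n1`. Thus the root condition `ψU = 1` is also the
normalization `zδ H1 = 1` that makes `H` a left eigenvector. -/
lemma delta_mul_firstRegen {S : Type*} (C : S → S → ℝ≥0∞) (ψ : S → ℝ≥0∞) (δ z : ℝ≥0∞) :
    z * δ * pair (occupation C ψ z) 1 = pair ψ (firstRegen C δ z) := by
  rw [pair_occupation, pair_firstRegen, ← ENNReal.tsum_mul_left]
  exact tsum_congr fun n => by ring

/-! ### Existence of the root and convergence beyond it -/

/-- A power series with non-negative coefficients that is at most `1` at `1`, not identically zero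
and extends beyond each point where it is at most `1` takes the value `1`. -/
lemma exists_powerSeries_eq_one (a : ℕ → ℝ≥0∞) (h0 : a 0 ≠ 0) (h1 : ∑' n, a n ≤ 1)
    (hext : ∀ t : ℝ≥0, 1 ≤ t → ∑' n : ℕ, (t : ℝ≥0∞) ^ (n + 1) * a n ≤ 1 →
      ∃ r : ℝ≥0, 1 < r ∧ ∑' n : ℕ, ((r * t : ℝ≥0) : ℝ≥0∞) ^ (n + 1) * a n < ∞) :
    ∃ t : ℝ≥0, 1 ≤ t ∧ ∑' n : ℕ, (t : ℝ≥0∞) ^ (n + 1) * a n = 1 := by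
  set φ : ℝ≥0 → ℝ≥0∞ := fun t => ∑' n : ℕ, (t : ℝ≥0∞) ^ (n + 1) * a n with hφ
  have hφt : ∀ t, φ t = ∑' n : ℕ, (t : ℝ≥0∞) ^ (n + 1) * a n := fun _ => rfl
  have hmono : Monotone φ := fun s t hst =>
    ENNReal.tsum_le_tsum fun n => by gcongr
  set A : Set ℝ≥0 := {t | 1 ≤ t ∧ φ t ≤ 1} with hA
  have hone : (1 : ℝ≥0) ∈ A := ⟨le_rfl, by simpa [hφ] using h1⟩
  have ha0 : a 0 ≠ ∞ := ((ENNReal.le_tsum 0).trans_lt (h1.trans_lt ENNReal.one_lt_top)).ne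
  have hbdd : BddAbove A := by
    refine ⟨(a 0)⁻¹.toNNReal, fun t ht => ?_⟩
    have h : (t : ℝ≥0∞) * a 0 ≤ 1 := by
      have := (ENNReal.le_tsum (f := fun n : ℕ => (t : ℝ≥0∞) ^ (n + 1) * a n) 0).trans ht.2
      simpa using this
    rw [← ENNReal.coe_le_coe, ENNReal.coe_toNNReal (ENNReal.inv_ne_top.2 h0)]
    exact ENNReal.le_inv_iff_mul_le.2 h
  set t := sSup A with ht
  have ht1 : 1 ≤ t := le_csSup hbdd hone
  have hle : φ t ≤ 1 := by
    -- The supremum is a limit of members of `A`, and each partial sum is continuous, so the bound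
    -- by one survives in the limit.
    refine ENNReal.tsum_le_of_sum_range_le fun N => ?_
    obtain ⟨s, -, hs, hsA⟩ := exists_seq_tendsto_sSup ⟨1, hone⟩ hbdd
    have hfin : ∀ n, a n ≠ ∞ := fun n =>
      ((ENNReal.le_tsum n).trans_lt (h1.trans_lt ENNReal.one_lt_top)).ne
    have hlim : Tendsto (fun k => ∑ n ∈ Finset.range N, (s k : ℝ≥0∞) ^ (n + 1) * a n) atTop
        (𝓝 (∑ n ∈ Finset.range N, (t : ℝ≥0∞) ^ (n + 1) * a n)) := by
      refine tendsto_finsetSum _ fun n _ => ?_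
      refine ENNReal.Tendsto.mul_const ?_ (Or.inr (hfin n))
      exact ENNReal.Tendsto.pow (ENNReal.tendsto_coe.2 hs)
    exact le_of_tendsto' hlim fun k => (ENNReal.sum_le_tsum _).trans (hsA k).2
  have hub : ∀ s ∈ A, s ≤ t := fun s hs => le_csSup hbdd hs
  clear_value t φ
  refine ⟨t, ht1, ?_⟩
  rw [← hφt]
  refine hle.antisymm ?_
  by_contra hlt
  rw [not_le] at hlt
  obtain ⟨r, hr, hrt⟩ := hext t ht1 (hφt t ▸ hle)
  rw [← hφt] at hrt
  -- As `φ (r * t)` is finite, a small enough multiple of it fits into the gap `1 - φ t`.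
  obtain ⟨α, hα0, hα1, hα⟩ : ∃ α : ℝ≥0, 0 < α ∧ α ≤ 1 ∧ φ t + α * φ (r * t) ≤ 1 := by
    have : Tendsto (fun k : ℕ => φ t + (((k : ℝ≥0) + 1)⁻¹ : ℝ≥0) * φ (r * t)) atTop
        (𝓝 (φ t + (0 : ℝ≥0) * φ (r * t))) := by
      refine tendsto_const_nhds.add (ENNReal.Tendsto.mul_const ?_ (Or.inr hrt.ne))
      refine ENNReal.tendsto_coe.2 ?_
      simpa using (tendsto_add_atTop_iff_nat 1).2 (tendsto_inv_atTop_nhds_zero_nat (𝕜 := ℝ≥0))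
    have hev := (tendsto_order.1 this).2 1 (by simpa using hlt)
    obtain ⟨k, hk⟩ := hev.exists
    exact ⟨((k : ℝ≥0) + 1)⁻¹, by positivity, inv_le_one_of_one_le₀ (by simp), hk.le⟩
  -- Convexity of powers at this point between `1` and `r` gives `φ (ρ * t) ≤ φ t + α * φ (r * t) ≤
  -- 1`, contradicting the maximality of `t`.
  set ρ : ℝ≥0 := (1 - α) * 1 + α * r with hρ
  have hαα : (1 - α) + α = 1 := tsub_add_cancel_of_le hα1
  have hρ1 : 1 < ρ := by
    calc (1 : ℝ≥0) = (1 - α) * 1 + α * 1 := by rw [← add_mul, hαα, one_mul]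
      _ < ρ := by
        exact add_lt_add_right (mul_lt_mul_of_pos_left hr hα0) _
  have hmem : ρ * t ∈ A := by
    refine ⟨one_le_mul hρ1.le ht1, le_trans ?_ hα⟩
    rw [hφt, hφt, hφt]
    rw [← ENNReal.tsum_mul_left, ← ENNReal.tsum_add]
    refine ENNReal.tsum_le_tsum fun n => ?_
    have hconv : ρ ^ (n + 1) ≤ (1 - α) * 1 ^ (n + 1) + α * r ^ (n + 1) := by
      have := (convexOn_pow (𝕜 := ℝ) (n + 1)).2 (show (1 : ℝ) ∈ Set.Ici 0 by simp)
        (show (r : ℝ) ∈ Set.Ici 0 by simp) (show (0 : ℝ) ≤ ((1 - α : ℝ≥0) : ℝ) by positivity)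
        (show (0 : ℝ) ≤ (α : ℝ) by positivity) (by exact_mod_cast hαα)
      simp only [smul_eq_mul] at this
      rw [hρ]
      exact_mod_cast this
    have hconv' : ρ ^ (n + 1) ≤ 1 + α * r ^ (n + 1) := by
      refine hconv.trans ?_
      simp
    calc ((ρ * t : ℝ≥0) : ℝ≥0∞) ^ (n + 1) * a n
        = ((ρ ^ (n + 1) : ℝ≥0) : ℝ≥0∞) * ((t : ℝ≥0∞) ^ (n + 1) * a n) := by
          push_cast; ring
      _ ≤ ((1 + α * r ^ (n + 1) : ℝ≥0) : ℝ≥0∞) * ((t : ℝ≥0∞) ^ (n + 1) * a n) := by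
          gcongr
      _ = _ := by push_cast; ring
  have : ρ * t ≤ t := hub _ hmem
  have h2 : t < ρ * t := lt_mul_of_one_lt_left (by positivity) hρ1
  exact absurd this (not_le.2 h2)

lemma le_firstRegen {S : Type*} (C : S → S → ℝ≥0∞) (δ z : ℝ≥0∞) (x : S) :
    z * δ ≤ firstRegen C δ z x := by
  rw [firstRegen_eq]
  simp

namespace IsSplit

variable {S : Type*} {B C : S → S → ℝ≥0∞} {ψ : S → ℝ≥0∞} {δ κ z : ℝ≥0∞}

lemma op_eq (h : IsSplit B C ψ δ κ) (f : S → ℝ≥0∞) (x : S) :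
    op B f x = op C f x + δ * pair ψ f := by
  simp only [op, pair, h.split, ← ENNReal.tsum_mul_left, ← ENNReal.tsum_add]
  exact tsum_congr fun y => by ring

lemma nonempty (h : IsSplit B C ψ δ κ) : Nonempty S := by
  by_contra hS
  rw [not_nonempty_iff] at hS
  simpa [pair] using h.mass

lemma delta_le_one (h : IsSplit B C ψ δ κ) : δ ≤ 1 := by
  obtain ⟨x⟩ := h.nonempty
  have := h.op_eq 1 x
  rw [h.mass, mul_one] at this
  exact (this ▸ le_add_self).trans (h.substoch x)

lemma delta_ne_top (h : IsSplit B C ψ δ κ) : δ ≠ ∞ :=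
  (h.delta_le_one.trans_lt ENNReal.one_lt_top).ne

lemma psi_ne_top (h : IsSplit B C ψ δ κ) (y : S) : ψ y ≠ ∞ := by
  have := (ENNReal.le_tsum y).trans (pair_one ψ ▸ h.mass).le
  exact (this.trans_lt ENNReal.one_lt_top).ne

lemma le_left (h : IsSplit B C ψ δ κ) (x y : S) : C x y ≤ B x y := by
  rw [h.split]
  exact le_self_add

lemma pair_le_of_le (h : IsSplit B C ψ δ κ) {f : S → ℝ≥0∞} {a : ℝ≥0∞} (hf : ∀ x, f x ≤ a) :
    pair ψ f ≤ a := by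
  have := pair_mono ψ (f := f) (g := a • 1) (fun x => by simpa using hf x)
  simpa [pair_smul, h.mass] using this

lemma le_pair_of_le (h : IsSplit B C ψ δ κ) {f : S → ℝ≥0∞} {a : ℝ≥0∞} (hf : ∀ x, a ≤ f x) :
    a ≤ pair ψ f := by
  have := pair_mono ψ (f := a • 1) (g := f) (fun x => by simpa using hf x)
  simpa [pair_smul, h.mass] using this

/-- In `U = zCU + zδ1`, the rows of `C` are at most `κψ`, so `CU ≤ κ ψU ≤ κ`: control of the average
`ψU` becomes a uniform bound. -/
lemma firstRegen_bounded (h : IsSplit B C ψ δ κ) (hz : z ≠ ∞)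
    (hle : pair ψ (firstRegen C δ z) ≤ 1) :
    ∃ K : ℝ≥0∞, K ≠ ∞ ∧ ∀ x, firstRegen C δ z x ≤ K := by
  refine ⟨z * κ + z * δ, ?_, fun x => ?_⟩
  · exact ENNReal.add_ne_top.2 ⟨ENNReal.mul_ne_top hz h.kappa_ne_top,
      ENNReal.mul_ne_top hz h.delta_ne_top⟩
  · rw [firstRegen_eq]
    simp only [Pi.add_apply, Pi.smul_apply, smul_eq_mul, Pi.one_apply, mul_one]
    gcongr
    calc op C (firstRegen C δ z) x ≤ op (fun _ y => κ * ψ y) (firstRegen C δ z) x :=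
          op_mono_left (fun x y => (h.le_left x y).trans (h.upper x y)) _ x
      _ = κ * pair ψ (firstRegen C δ z) := by
          simp only [op, pair, ← ENNReal.tsum_mul_left, mul_assoc]
      _ ≤ κ := mul_le_of_le_one_right' hle

/-- The radius of convergence of `∑ z ^ n ψ C ^ n 1` lies strictly beyond each point at which the
generating function of the first regeneration is at most one. -/
lemma exists_extension (h : IsSplit B C ψ δ κ) (hz0 : z ≠ 0) (hz : z ≠ ∞)
    (hle : pair ψ (firstRegen C δ z) ≤ 1) :
    ∃ r : ℝ≥0, 1 < r ∧ pair ψ (firstRegen C δ (r * z)) < ∞ := by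
  obtain ⟨K, hK, hUK⟩ := h.firstRegen_bounded hz hle
  set U := firstRegen C δ z with hU
  obtain ⟨x₀⟩ := h.nonempty
  set a := z * δ with ha
  have ha0 : a ≠ 0 := mul_ne_zero hz0 h.delta_ne_zero
  have hat : a ≠ ∞ := ENNReal.mul_ne_top hz h.delta_ne_top
  have haU : ∀ x, a ≤ U x := fun x => le_firstRegen C δ z x
  have hK0 : K ≠ 0 := fun hK0 => ha0 (le_zero_iff.1 (((haU x₀).trans (hUK x₀)).trans hK0.le))
  obtain ⟨p, hp⟩ : ∃ p : ℝ≥0, (p : ℝ≥0∞) = a / K :=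
    ⟨(a / K).toNNReal, ENNReal.coe_toNNReal (ENNReal.div_ne_top hat hK0)⟩
  have hp0 : 0 < p := by
    rw [← ENNReal.coe_pos, hp]
    exact ENNReal.div_pos ha0 hK
  have hp1 : p ≤ 1 := by
    rw [← ENNReal.coe_le_one_iff, hp]
    exact ENNReal.div_le_of_le_mul (by simpa using (haU x₀).trans (hUK x₀))
  set q : ℝ≥0 := 1 - p with hq
  have hqp : q + p = 1 := tsub_add_cancel_of_le hp1
  have hq1 : q < 1 := by
    rw [← hqp]
    exact lt_add_of_pos_right _ hp0
  -- Since `zCU = U - a` and `a = pK ≥ pU`, one application of `zC` shrinks `U` by the factor `q = 1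
  -- - p`.
  have hstep : z • op C U ≤ (q : ℝ≥0∞) • U := by
    intro x
    have h1 : U x ≤ q * U x + a := by
      calc U x = ((q + p : ℝ≥0) : ℝ≥0∞) * U x := by rw [hqp]; simp
        _ = q * U x + a / K * U x := by push_cast; rw [add_mul, hp]
        _ ≤ q * U x + a / K * K := by gcongr; exact hUK x
        _ = q * U x + a := by rw [ENNReal.div_mul_cancel hK0 hK]
    have h2 := congrFun (firstRegen_eq C δ z) x
    simp only [Pi.add_apply, Pi.smul_apply, smul_eq_mul, Pi.one_apply, mul_one] at h2 ⊢
    rw [← hU, ← ha] at h2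
    rw [h2] at h1
    nth_rewrite 2 [← h2] at h1
    exact (ENNReal.add_le_add_iff_right hat).1 h1
  have hiter : ∀ n, z ^ n • (op C)^[n] U ≤ (q : ℝ≥0∞) ^ n • U := by
    intro n
    induction n with
    | zero => simp
    | succ n ih =>
      calc z ^ (n + 1) • (op C)^[n + 1] U = z ^ n • (op C)^[n] (z • op C U) := by
            rw [iterate_op_smul, smul_smul, pow_succ, Function.iterate_succ_apply]
        _ ≤ z ^ n • (op C)^[n] ((q : ℝ≥0∞) • U) := by
            intro x
            exact mul_le_mul_right (iterate_op_mono C n hstep x) _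
        _ = (q : ℝ≥0∞) • z ^ n • (op C)^[n] U := by rw [iterate_op_smul, smul_comm]
        _ ≤ (q : ℝ≥0∞) • (q : ℝ≥0∞) ^ n • U := fun x => mul_le_mul_right (ih x) _
        _ = _ := by rw [smul_smul, pow_succ']
  have hone : ∀ n x, a * (z ^ n * (op C)^[n] 1 x) ≤ q ^ n * K := by
    intro n x
    calc a * (z ^ n * (op C)^[n] 1 x) = z ^ n * (op C)^[n] (a • 1) x := by
          rw [iterate_op_smul, Pi.smul_apply, smul_eq_mul]; ring
      _ ≤ z ^ n * (op C)^[n] U x :=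
          mul_le_mul_right (iterate_op_mono C n (fun x => by simpa using haU x) x) _
      _ ≤ q ^ n * U x := hiter n x
      _ ≤ q ^ n * K := by gcongr; exact hUK x
  -- Any `r` with `1 < r` and `rq < 1` would do; the terms are then dominated by a geometric series
  -- of ratio `rq`.
  set r : ℝ≥0 := 2 / (1 + q) with hr
  have hr1 : 1 < r := by
    rw [hr, lt_div_iff₀ (by positivity), one_mul]
    calc 1 + q < 1 + 1 := by gcongr
      _ = 2 := by norm_num
  have hrq : r * q < 1 := by
    rw [hr, div_mul_eq_mul_div, div_lt_one (by positivity), two_mul]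
    gcongr
  refine ⟨r, hr1, ?_⟩
  refine (h.pair_le_of_le (a := r * K * (1 - ((r * q : ℝ≥0) : ℝ≥0∞))⁻¹) fun x => ?_).trans_lt ?_
  · rw [firstRegen, ← ENNReal.tsum_geometric, ← ENNReal.tsum_mul_left]
    refine ENNReal.tsum_le_tsum fun n => ?_
    calc (r * z) ^ (n + 1) * δ * (op C)^[n] 1 x
        = r ^ (n + 1) * (a * (z ^ n * (op C)^[n] 1 x)) := by rw [ha]; ring
      _ ≤ r ^ (n + 1) * (q ^ n * K) := mul_le_mul_right (hone n x) _
      _ = _ := by push_cast; ring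
  · refine ENNReal.mul_lt_top (ENNReal.mul_lt_top ENNReal.coe_lt_top hK.lt_top) ?_
    rw [ENNReal.inv_lt_top]
    exact tsub_pos_of_lt (by exact_mod_cast hrq)

lemma firstRegen_one_le (h : IsSplit B C ψ δ κ) : pair ψ (firstRegen C δ 1) ≤ 1 := by
  refine h.pair_le_of_le fun x => ENNReal.tsum_le_of_sum_range_le fun N => ?_
  -- The sum telescopes because `δ1 + C1 ≤ 1`: the probabilities of regenerating within `N` steps
  -- and of surviving them without regeneration add up to at most one.
  have key : ∑ n ∈ Finset.range N, 1 ^ (n + 1) * δ * (op C)^[n] 1 x + (op C)^[N] 1 x ≤ 1 := by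
    induction N with
    | zero => simp
    | succ N ih =>
      refine le_trans ?_ ih
      rw [Finset.sum_range_succ, add_assoc]
      gcongr
      have h1 : δ • 1 + op C 1 ≤ (1 : S → ℝ≥0∞) := by
        intro x
        have := h.op_eq 1 x
        rw [h.mass, mul_one, add_comm] at this
        simpa [this] using h.substoch x
      have h2 := iterate_op_mono C N h1 x
      rw [iterate_op_add, iterate_op_smul] at h2
      simpa [Function.iterate_succ_apply] using h2
  exact le_self_add.trans key

/-- The generating function of the first regeneration takes the value one at some `t ≥ 1`. -/
lemma exists_root (h : IsSplit B C ψ δ κ) :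
    ∃ t : ℝ≥0, 1 ≤ t ∧ pair ψ (firstRegen C δ t) = 1 := by
  simp only [pair_firstRegen]
  refine exists_powerSeries_eq_one (fun n => δ * pair ψ ((op C)^[n] 1)) ?_ ?_ fun t ht hle => ?_
  · simpa [h.mass] using h.delta_ne_zero
  · simpa [pair_firstRegen] using h.firstRegen_one_le
  · rw [← pair_firstRegen] at hle
    obtain ⟨r, hr, hlt⟩ := h.exists_extension
      (ENNReal.coe_ne_zero.2 (zero_lt_one.trans_le ht).ne') ENNReal.coe_ne_top hle
    exact ⟨r, hr, by simpa [pair_firstRegen] using hlt⟩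

lemma op_firstRegen (h : IsSplit B C ψ δ κ) (hroot : pair ψ (firstRegen C δ z) = 1) :
    z • op B (firstRegen C δ z) = firstRegen C δ z := by
  ext x
  conv_rhs => rw [firstRegen_eq]
  simp only [Pi.add_apply, Pi.smul_apply, smul_eq_mul, Pi.one_apply, h.op_eq, hroot]
  ring

end IsSplit

/-! ### The left eigenvector and the pairing of the two eigenvectors -/

lemma occupation_eq {S : Type*} (C : S → S → ℝ≥0∞) (ψ : S → ℝ≥0∞) (z : ℝ≥0∞) (y : S) :
    occupation C ψ z y = ψ y + z * ∑' x, occupation C ψ z x * C x y := by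
  have h : ∑' x, occupation C ψ z x * C x y = pair (occupation C ψ z) (op C (point y)) := by
    simp only [pair, op_point]
  rw [h, pair_occupation, occupation, tsum_eq_zero_add' ENNReal.summable,
    ← ENNReal.tsum_mul_left]
  congr 1
  · simp [pair_point]
  · refine tsum_congr fun n => ?_
    rw [pow_succ', mul_assoc, Function.iterate_succ_apply]

lemma le_occupation {S : Type*} (C : S → S → ℝ≥0∞) (ψ : S → ℝ≥0∞) (z : ℝ≥0∞) (y : S) :
    ψ y ≤ occupation C ψ z y := by
  rw [occupation_eq]
  exact le_self_add

namespace IsSplit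

variable {S : Type*} {B C : S → S → ℝ≥0∞} {ψ : S → ℝ≥0∞} {δ κ z : ℝ≥0∞}

lemma sum_split (h : IsSplit B C ψ δ κ) (η : S → ℝ≥0∞) (y : S) :
    ∑' x, η x * B x y = ∑' x, η x * C x y + δ * pair η 1 * ψ y := by
  simp only [h.split, mul_add, ENNReal.tsum_add, pair_one]
  congr 1
  rw [ENNReal.tsum_mul_right]
  ring

lemma occupation_mul (h : IsSplit B C ψ δ κ) (hroot : pair ψ (firstRegen C δ z) = 1) (y : S) :
    z * ∑' x, occupation C ψ z x * B x y = occupation C ψ z y := by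
  rw [h.sum_split, occupation_eq C ψ z y, mul_add, ← mul_assoc, ← mul_assoc,
    delta_mul_firstRegen, hroot, one_mul, add_comm]

lemma pair_occupation_one_ne_top (h : IsSplit B C ψ δ κ) (hz0 : z ≠ 0)
    (hroot : pair ψ (firstRegen C δ z) = 1) : pair (occupation C ψ z) 1 ≠ ∞ := by
  intro htop
  have := delta_mul_firstRegen C ψ δ z
  rw [htop, hroot, ENNReal.mul_top (mul_ne_zero hz0 h.delta_ne_zero)] at this
  exact ENNReal.top_ne_one this

lemma occupation_ne_top (h : IsSplit B C ψ δ κ) (hz0 : z ≠ 0)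
    (hroot : pair ψ (firstRegen C δ z) = 1) (y : S) : occupation C ψ z y ≠ ∞ := by
  refine ne_top_of_le_ne_top (h.pair_occupation_one_ne_top hz0 hroot) ?_
  rw [pair_one]
  exact ENNReal.le_tsum y

lemma le_pair_occupation_firstRegen (C : S → S → ℝ≥0∞) (ψ : S → ℝ≥0∞) (δ z : ℝ≥0∞) :
    z * δ * pair (occupation C ψ z) 1 ≤ pair (occupation C ψ z) (firstRegen C δ z) := by
  rw [← pair_smul]
  exact pair_mono _ fun x => by simpa using le_firstRegen C δ z x

lemma pair_occupation_firstRegen_ne_zero (hroot : pair ψ (firstRegen C δ z) = 1) :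
    pair (occupation C ψ z) (firstRegen C δ z) ≠ 0 := by
  intro h0
  have := le_pair_occupation_firstRegen C ψ δ z
  rw [h0, delta_mul_firstRegen, hroot] at this
  simp at this

lemma pair_occupation_firstRegen_ne_top (h : IsSplit B C ψ δ κ) (hz0 : z ≠ 0) (hz : z ≠ ∞)
    (hroot : pair ψ (firstRegen C δ z) = 1) :
    pair (occupation C ψ z) (firstRegen C δ z) ≠ ∞ := by
  obtain ⟨K, hK, hUK⟩ := h.firstRegen_bounded hz hroot.le
  refine ne_top_of_le_ne_top
    (ENNReal.mul_ne_top hK (h.pair_occupation_one_ne_top hz0 hroot)) ?_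
  rw [← pair_smul]
  exact pair_mono _ fun x => by simpa using hUK x

/-! ### Uniqueness of eigenvectors -/

/-- Uniqueness of the positive column eigenvector. -/
lemma eq_smul_firstRegen (h : IsSplit B C ψ δ κ) (hz0 : z ≠ 0)
    (hroot : pair ψ (firstRegen C δ z) = 1) {u : S → ℝ≥0∞} (hu : ∀ x, u x ≠ ∞)
    (hBu : z • op B u = u) : pair ψ u ≠ ∞ ∧ u = pair ψ u • firstRegen C δ z := by
  obtain ⟨x₀⟩ := h.nonempty
  set a := pair ψ u with ha
  have hdec : ∀ x, u x = z * op C u x + a * (z * δ) := by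
    intro x
    conv_lhs => rw [← hBu]
    rw [Pi.smul_apply, smul_eq_mul, h.op_eq]
    ring
  have hfin : a ≠ ∞ := by
    intro htop
    refine hu x₀ ?_
    rw [hdec, htop, ENNReal.top_mul (mul_ne_zero hz0 h.delta_ne_zero), add_top]
  refine ⟨hfin, ?_⟩
  -- Iterating `u = zCu + a zδ1` gives `a` times a partial sum of `U` plus a non-negative remainder,
  -- which is discarded to obtain `aU ≤ u`.
  have hsum : ∀ N x, u x = a * ∑ n ∈ Finset.range N, z ^ (n + 1) * δ * (op C)^[n] 1 x +
      z ^ N * (op C)^[N] u x := by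
    intro N
    induction N with
    | zero => simp
    | succ N ih =>
      intro x
      have hdec' : u = z • op C u + (a * (z * δ)) • 1 := by
        ext x
        simpa using hdec x
      have h3 : (op C)^[N] u x = z * (op C)^[N + 1] u x + a * (z * δ) * (op C)^[N] 1 x := by
        conv_lhs => rw [hdec']
        rw [iterate_op_add, iterate_op_smul, iterate_op_smul, Function.iterate_succ_apply]
        rfl
      rw [ih x, h3, Finset.sum_range_succ]
      ring
  have hle : a • firstRegen C δ z ≤ u := by
    intro x
    simp only [Pi.smul_apply, smul_eq_mul, firstRegen, ← ENNReal.tsum_mul_left]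
    refine ENNReal.tsum_le_of_sum_range_le fun N => ?_
    rw [← Finset.mul_sum, hsum N x]
    exact le_self_add
  -- Both sides pair with `ψ` to `a`, because `ψU = 1`; this replaces a proof that the remainder
  -- tends to zero.
  refine (eq_of_le_of_pair_eq h.psi_ne_zero h.psi_ne_top hle ?_ ?_).symm
  · rw [pair_smul, hroot, mul_one]
  · rwa [pair_smul, hroot, mul_one]

/-- Uniqueness of the positive row eigenvector. -/
lemma eq_smul_occupation (h : IsSplit B C ψ δ κ) (hz0 : z ≠ 0)
    (hroot : pair ψ (firstRegen C δ z) = 1) {η : S → ℝ≥0∞} (hη : ∀ x, η x ≠ ∞)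
    (hBη : ∀ y, z * ∑' x, η x * B x y = η y) :
    z * δ * pair η 1 ≠ ∞ ∧ η = (z * δ * pair η 1) • occupation C ψ z := by
  obtain ⟨x₀⟩ := h.nonempty
  set a := z * δ * pair η 1 with ha
  have hdec : ∀ y, η y = z * ∑' x, η x * C x y + a * ψ y := by
    intro y
    conv_lhs => rw [← hBη, h.sum_split]
    rw [ha]
    ring
  have hfin : a ≠ ∞ := by
    intro htop
    refine hη x₀ ?_
    rw [hdec, htop, ENNReal.top_mul (h.psi_ne_zero x₀), add_top]
  refine ⟨hfin, ?_⟩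
  have hpair : ∀ f, pair η f = z * pair η (op C f) + a * pair ψ f := by
    intro f
    rw [pair_op]
    simp only [pair, ← ENNReal.tsum_mul_left, ← ENNReal.tsum_add]
    refine tsum_congr fun y => ?_
    conv_lhs => rw [hdec y]
    ring
  have hsum : ∀ N f, pair η f = a * ∑ n ∈ Finset.range N, z ^ n * pair ψ ((op C)^[n] f) +
      z ^ N * pair η ((op C)^[N] f) := by
    intro N f
    induction N with
    | zero => simp
    | succ N ih =>
      rw [ih, hpair ((op C)^[N] f), Finset.sum_range_succ, Function.iterate_succ_apply']
      ring
  have hle : a • occupation C ψ z ≤ η := by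
    intro y
    simp only [Pi.smul_apply, smul_eq_mul, occupation, ← ENNReal.tsum_mul_left]
    refine ENNReal.tsum_le_of_sum_range_le fun N => ?_
    rw [← Finset.mul_sum, ← pair_point η y, hsum N]
    exact le_self_add
  -- For rows the comparison is made by total mass. The factor `a = zδ η1` and `zδ H1 = 1` give `aH`
  -- the same mass as `η`.
  have hflip : ∀ f : S → ℝ≥0∞, pair 1 f = pair f 1 := fun f => by simp [pair]
  have hmass : pair 1 (a • occupation C ψ z) = pair 1 η := by
    rw [pair_smul, hflip, hflip, ha]
    calc z * δ * pair η 1 * pair (occupation C ψ z) 1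
        = z * δ * pair (occupation C ψ z) 1 * pair η 1 := by ring
      _ = pair η 1 := by rw [delta_mul_firstRegen, hroot, one_mul]
  refine (eq_of_le_of_pair_eq (η := 1) (by simp) (by simp) hle hmass ?_).symm
  rw [pair_smul, hflip]
  exact ENNReal.mul_ne_top hfin (h.pair_occupation_one_ne_top hz0 hroot)

end IsSplit

/-! ### Convergence of the normalized powers -/

lemma iterate_smul_op {S : Type*} (M : S → S → ℝ≥0∞) (z : ℝ≥0∞) (n : ℕ) (f : S → ℝ≥0∞) :
    (op (z • M))^[n] f = z ^ n • (op M)^[n] f := by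
  induction n generalizing f with
  | zero => simp
  | succ n ih =>
    have : op (z • M) f = z • op M f := by
      ext x
      simp only [op, Pi.smul_apply, smul_eq_mul, ← ENNReal.tsum_mul_left, mul_assoc]
    rw [Function.iterate_succ_apply, ih, this, iterate_op_smul, smul_smul, ← pow_succ,
      Function.iterate_succ_apply]

/-- Convergence of the powers of a matrix that has invariant vectors `u` and `η` and dominates a
multiple of `u η`. -/
lemma tendsto_iterate_of_minorized {S : Type*} {M : S → S → ℝ≥0∞} {u η : S → ℝ≥0∞}
    (hu0 : ∀ x, u x ≠ 0) (hu : ∀ x, u x ≠ ∞) (hη : ∀ y, η y ≠ ∞)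
    (hm0 : pair η u ≠ 0) (hm : pair η u ≠ ∞) (hMu : op M u = u)
    (hηM : ∀ y, ∑' x, η x * M x y = η y) {ε q : ℝ≥0∞} (hεq : ε + q = 1) (hε : ε ≠ 0)
    (hmin : ∀ x y, ε * (u x * η y / pair η u) ≤ M x y) (x y : S) :
    Tendsto (fun n : ℕ => (op M)^[n] (point y) x) atTop (𝓝 (u x * η y / pair η u)) := by
  set m := pair η u with hmdef
  -- The remainder after subtracting `ε` times the projection `uη/m` has `u` and `η` as eigenvectors
  -- with eigenvalue `q = 1 - ε`.
  set A : S → S → ℝ≥0∞ := fun x y => M x y - ε * (u x * η y / m) with hA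
  have hMA : ∀ f x, op M f x = op A f x + ε * (u x * (pair η f / m)) := by
    intro f x
    have h1 : u x * (pair η f / m) = ∑' y, u x * η y / m * f y := by
      simp only [pair, div_eq_mul_inv, ← ENNReal.tsum_mul_left, ← ENNReal.tsum_mul_right]
      exact tsum_congr fun y => by ring
    rw [h1, ← ENNReal.tsum_mul_left, op, op, ← ENNReal.tsum_add]
    refine tsum_congr fun y => ?_
    rw [← mul_assoc, ← add_mul, hA, tsub_add_cancel_of_le (hmin x y)]
  have hε1 : ε ≤ 1 := hεq ▸ le_self_add
  have hεtop : ε ≠ ∞ := (hε1.trans_lt ENNReal.one_lt_top).ne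
  have hAu : op A u = q • u := by
    ext x
    have h1 := hMA u x
    rw [hMu, ← hmdef, ENNReal.div_self hm0 hm, mul_one] at h1
    have h2 : u x = q * u x + ε * u x := by
      rw [← add_mul, add_comm q, hεq, one_mul]
    exact ((ENNReal.add_left_inj (ENNReal.mul_ne_top hεtop (hu x))).1 (h2.symm.trans h1)).symm
  have hηpair : ∀ f, pair η (op M f) = pair η f := by
    intro f
    rw [pair_op]
    simp only [hηM]
    rfl
  have hηA : ∀ f, pair η f ≠ ∞ → pair η (op A f) = q * pair η f := by
    intro f hf
    have h1 := hηpair f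
    have h2 : op M f = op A f + (ε * (pair η f / m)) • u := by
      ext x
      rw [hMA f x, Pi.add_apply, Pi.smul_apply, smul_eq_mul]
      ring
    rw [h2, pair_add, pair_smul, mul_assoc, ENNReal.div_mul_cancel hm0 hm] at h1
    have h3 : pair η f = q * pair η f + ε * pair η f := by
      rw [← add_mul, add_comm q, hεq, one_mul]
    exact (ENNReal.add_left_inj (ENNReal.mul_ne_top hεtop hf)).1 (h1.trans h3)
  have hqtop : q ≠ ∞ := ne_top_of_le_ne_top ENNReal.one_ne_top (hεq ▸ le_add_self)
  have hηAn : ∀ n, pair η ((op A)^[n] (point y)) = q ^ n * η y := by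
    intro n
    induction n with
    | zero => simp [pair_point]
    | succ n ih =>
      rw [Function.iterate_succ_apply', hηA, ih, pow_succ']
      · ring
      · rw [ih]
        exact ENNReal.mul_ne_top (ENNReal.pow_ne_top hqtop) (hη y)
  have hMiter : ∀ n, (op M)^[n] u = u := fun n => Function.iterate_fixed hMu n
  have hdecomp : ∀ n x, (op M)^[n] (point y) x =
      (op A)^[n] (point y) x + (∑ k ∈ Finset.range n, ε * q ^ k) * (u x * η y / m) := by
    intro n
    induction n with
    | zero => simp
    | succ n ih =>
      intro x
      have h1 : (op M)^[n] (point y) =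
          (op A)^[n] (point y) + ((∑ k ∈ Finset.range n, ε * q ^ k) * (η y / m)) • u := by
        ext x
        rw [ih x, Pi.add_apply, Pi.smul_apply, smul_eq_mul, div_eq_mul_inv, div_eq_mul_inv]
        ring
      rw [Function.iterate_succ_apply', h1, op_add, op_smul, hMu, Pi.add_apply, hMA, hηAn,
        Finset.sum_range_succ, Function.iterate_succ_apply', Pi.smul_apply, smul_eq_mul]
      simp only [div_eq_mul_inv]
      ring
  have hgeom : ∀ n, (∑ k ∈ Finset.range n, ε * q ^ k) + q ^ n = 1 := by
    intro n
    induction n with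
    | zero => simp
    | succ n ih =>
      rw [Finset.sum_range_succ, add_assoc, pow_succ', ← add_mul, hεq, one_mul, ih]
  have hq1 : q < 1 := by
    rw [← hεq]
    nth_rewrite 1 [← zero_add q]
    exact ENNReal.add_lt_add_right hqtop (pos_iff_ne_zero.2 hε)
  have hqn : Tendsto (fun n : ℕ => q ^ n) atTop (𝓝 0) :=
    ENNReal.tendsto_pow_atTop_nhds_zero_of_lt_one hq1
  have hAn : Tendsto (fun n : ℕ => (op A)^[n] (point y) x) atTop (𝓝 0) := by
    -- The indicator of `y` is at most `u / u(y)`, on which `A` acts as multiplication by `q`.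
    have hbound : ∀ n x, (op A)^[n] (point y) x ≤ (u y)⁻¹ * (q ^ n * u x) := by
      intro n x
      have h1 : (op A)^[n] u = q ^ n • u := by
        induction n with
        | zero => simp
        | succ n ih => rw [Function.iterate_succ_apply, hAu, iterate_op_smul, ih, smul_smul,
            pow_succ']
      have h2 : point y ≤ (u y)⁻¹ • u := by
        intro w
        by_cases hw : w = y
        · subst hw
          simp [point, ENNReal.inv_mul_cancel (hu0 w) (hu w)]
        · simp [point, hw]
      have h3 := iterate_op_mono A n h2 x
      rwa [iterate_op_smul, h1] at h3
    refine tendsto_of_tendsto_of_tendsto_of_le_of_le tendsto_const_nhds ?_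
      (fun n => zero_le) (fun n => hbound n x)
    have h1 := ENNReal.Tendsto.const_mul (a := (u y)⁻¹)
      (ENNReal.Tendsto.mul_const hqn (Or.inr (hu x))) (Or.inr (ENNReal.inv_ne_top.2 (hu0 y)))
    simpa using h1
  have hsum : Tendsto (fun n : ℕ => ∑ k ∈ Finset.range n, ε * q ^ k) atTop (𝓝 1) := by
    have h1 : ∀ n, ∑ k ∈ Finset.range n, ε * q ^ k = 1 - q ^ n := fun n =>
      ENNReal.eq_sub_of_add_eq (ENNReal.pow_ne_top hqtop) (hgeom n)
    simp only [h1]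
    simpa using ENNReal.Tendsto.sub tendsto_const_nhds hqn (Or.inl ENNReal.one_ne_top)
  have hL : u x * η y / m ≠ ∞ := ENNReal.div_ne_top (ENNReal.mul_ne_top (hu x) (hη y)) hm0
  simp only [hdecomp]
  simpa using hAn.add (ENNReal.Tendsto.mul_const hsum (Or.inr hL))

lemma IsSplit.tendsto_iterate {S : Type*} {B C : S → S → ℝ≥0∞} {ψ : S → ℝ≥0∞} {δ κ z : ℝ≥0∞}
    (h : IsSplit B C ψ δ κ) (hz0 : z ≠ 0) (hz : z ≠ ∞)
    (hroot : pair ψ (firstRegen C δ z) = 1) (x y : S) :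
    Tendsto (fun n : ℕ => z ^ n * (op B)^[n] (point y) x) atTop
      (𝓝 (firstRegen C δ z x * occupation C ψ z y /
        pair (occupation C ψ z) (firstRegen C δ z))) := by
  obtain ⟨K, hK, hUK⟩ := h.firstRegen_bounded hz hroot.le
  have hm0 := IsSplit.pair_occupation_firstRegen_ne_zero hroot
  have hm := h.pair_occupation_firstRegen_ne_top hz0 hz hroot
  set m := pair (occupation C ψ z) (firstRegen C δ z)
  -- From `H = zHB`, `B ≤ κψ` and `zδ H1 = 1` one gets `δH ≤ κψ`; since `δψ(y) ≤ B(x,y)`, every row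
  -- of `B` dominates a multiple of `H`.
  have hH : ∀ x y, δ * δ * occupation C ψ z y ≤ κ * B x y := by
    intro x y
    have h1 : δ * occupation C ψ z y ≤ κ * ψ y := by
      calc δ * occupation C ψ z y = δ * (z * ∑' x, occupation C ψ z x * B x y) := by
            rw [h.occupation_mul hroot]
        _ ≤ δ * (z * ∑' x, occupation C ψ z x * (κ * ψ y)) := by
            gcongr
            exact h.upper _ _
        _ = z * δ * pair (occupation C ψ z) 1 * (κ * ψ y) := by
            rw [ENNReal.tsum_mul_right, pair_one]
            ring
        _ = κ * ψ y := by rw [delta_mul_firstRegen, hroot, one_mul]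
    calc δ * δ * occupation C ψ z y = δ * (δ * occupation C ψ z y) := mul_assoc _ _ _
      _ ≤ δ * (κ * ψ y) := by gcongr
      _ = κ * (δ * ψ y) := by ring
      _ ≤ κ * B x y := by
        gcongr
        rw [h.split]
        exact le_add_self
  -- This combines `U ≤ K` with `hH`; the added `1` avoids checking that `K * κ` is non-zero.
  set e := z * m * (δ * δ) / (K * κ + 1) with he
  have hden : K * κ + 1 ≠ ∞ := by
    finiteness [h.kappa_ne_top]
  have he0 : e ≠ 0 := ENNReal.div_ne_zero.2
    ⟨mul_ne_zero (mul_ne_zero hz0 hm0) (mul_ne_zero h.delta_ne_zero h.delta_ne_zero), hden⟩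
  have hmin : ∀ x y, e * (firstRegen C δ z x * occupation C ψ z y / m) ≤ (z • B) x y := by
    intro x y
    calc e * (firstRegen C δ z x * occupation C ψ z y / m)
        ≤ e * (K * occupation C ψ z y / m) := by gcongr; exact hUK x
      _ = z * (K * (δ * δ * occupation C ψ z y)) * (m / m) / (K * κ + 1) := by
          rw [he]
          simp only [div_eq_mul_inv]
          ring
      _ ≤ z * (K * (κ * B x y)) * (m / m) / (K * κ + 1) := by
          gcongr z * (K * ?_) * (m / m) / (K * κ + 1)
          exact hH x y
      _ = z * B x y * (K * κ) / (K * κ + 1) := by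
          rw [ENNReal.div_self hm0 hm]
          ring_nf
      _ ≤ z * B x y * (K * κ + 1) / (K * κ + 1) := by
          gcongr
          exact le_self_add
      _ = z * B x y := ENNReal.mul_div_cancel_right (by simp) hden
      _ = (z • B) x y := rfl
  -- The minimum with one provides a complementary weight `q` with `ε + q = 1`.
  have key := tendsto_iterate_of_minorized (M := z • B) (u := firstRegen C δ z)
    (η := occupation C ψ z) (ε := min e 1) (q := 1 - min e 1)
    (fun x => (lt_of_lt_of_le (pos_iff_ne_zero.2 (mul_ne_zero hz0 h.delta_ne_zero))
      (le_firstRegen C δ z x)).ne')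
    (fun x => ne_top_of_le_ne_top hK (hUK x)) (h.occupation_ne_top hz0 hroot) hm0 hm
    (by
      have := iterate_smul_op B z 1 (firstRegen C δ z)
      simpa [h.op_firstRegen hroot] using this)
    (fun y => by
      rw [← h.occupation_mul hroot y, ← ENNReal.tsum_mul_left]
      exact tsum_congr fun x => by simp only [Pi.smul_apply, smul_eq_mul]; ring)
    (add_tsub_cancel_of_le (min_le_right _ _))
    (by simp [he0])
    (fun x y => (mul_le_mul_left (min_le_left _ _) _).trans (hmin x y)) x y
  simpa [iterate_smul_op] using key

/-! ### The chain killed at the first regeneration -/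

/-- `B̃(x, y) = B(x, y) - δ ψ(y)`. -/
def residual {S : Type*} (B : S → S → ℝ≥0) (v : S) (c₁ : ℝ≥0) (x y : S) : ℝ≥0∞ :=
  B x y - delta B v c₁ * psi B v y

/-! ### Positivity of the entries and the splitting of `B` -/

section Positivity

variable {S : Type*} {B : S → S → ℝ≥0} {v : S} {c₁ c₂ : ℝ≥0}

/-- A zero column of `B` stays zero in every positive power, so `y` could not be reached even from
itself. -/
lemma IsIrreducible.exists_ne_zero (hirr : IsIrreducible B) (y : S) : ∃ x, B x y ≠ 0 := by
  by_contra! hy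
  obtain ⟨n, hn, hpos⟩ := hirr y y
  obtain ⟨n, rfl⟩ := Nat.exists_eq_succ_of_ne_zero (Nat.one_le_iff_ne_zero.1 hn)
  have : ∀ n x, matPow B (n + 1) x y = 0 := by
    intro n
    induction n with
    | zero =>
      intro x
      rw [matPow, ENNReal.tsum_eq_zero]
      intro w
      by_cases hw : w = y
      · subst hw
        simp [hy x]
      · simp [matPow, hw]
    | succ n ih =>
      intro x
      rw [matPow]
      simp [ih]
  exact hpos.ne' (this n y)

/-- The upper comparison would spread a zero of row `v` to its whole column. The lower comparison
then makes all entries of `B` positive. -/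
lemma RowsComparable.row_ne_zero (h : RowsComparable B v c₁ c₂) (hirr : IsIrreducible B) (y : S) :
    B v y ≠ 0 := by
  intro hy
  obtain ⟨x, hx⟩ := hirr.exists_ne_zero y
  have := h.upper x y
  rw [hy, mul_zero] at this
  exact hx (le_zero_iff.1 this)

lemma RowsComparable.ne_zero (h : RowsComparable B v c₁ c₂) (hirr : IsIrreducible B) (x y : S) :
    B x y ≠ 0 := by
  refine (lt_of_lt_of_le ?_ (h.lower x y)).ne'
  exact mul_pos h.pos (pos_iff_ne_zero.2 (h.row_ne_zero hirr y))

lemma RowsComparable.period_eq_one (h : RowsComparable B v c₁ c₂) (hirr : IsIrreducible B)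
    (w : S) : period B w = 1 := by
  rw [period, ← Nat.dvd_one]
  refine Nat.setGcd_dvd_of_mem ⟨le_rfl, ?_⟩
  rw [matPow_eq_iterate, Function.iterate_one, op_point]
  exact ENNReal.coe_pos.2 (pos_iff_ne_zero.2 (h.ne_zero hirr w w))

lemma RowsComparable.residual_add (h : RowsComparable B v c₁ c₂) (hB : IsSubstochastic B)
    (x y : S) : residual B v c₁ x y + delta B v c₁ * psi B v y = B x y := by
  refine tsub_add_cancel_of_le ?_
  rw [delta_mul_psi hB]
  exact_mod_cast h.lower x y

/-- The constant `κ` arises from `B(v,y) = ψ(y) ∑_w B(v,w)` and the upper comparison. -/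
lemma RowsComparable.isSplit (h : RowsComparable B v c₁ c₂) (hB : IsSubstochastic B)
    (hirr : IsIrreducible B) :
    IsSplit (fun x y => (B x y : ℝ≥0∞)) (residual B v c₁) (psi B v) (delta B v c₁)
      (c₂ * ∑' w, (B v w : ℝ≥0∞)) := by
  have hs : (∑' w, (B v w : ℝ≥0∞)) ≠ ∞ := ((hB v).trans_lt ENNReal.one_lt_top).ne
  have hs0 : (∑' w, (B v w : ℝ≥0∞)) ≠ 0 := fun h0 =>
    h.row_ne_zero hirr v (ENNReal.coe_eq_zero.1 (ENNReal.tsum_eq_zero.1 h0 v))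
  refine ⟨fun x y => (h.residual_add hB x y).symm, ?_, fun y => ?_, ?_, fun x => ?_,
    fun x y => ?_, ENNReal.mul_ne_top ENNReal.coe_ne_top hs⟩
  · rw [pair_one]
    simp only [psi, div_eq_mul_inv]
    rw [ENNReal.tsum_mul_right, ENNReal.mul_inv_cancel hs0 hs]
  · exact ENNReal.div_ne_zero.2 ⟨ENNReal.coe_ne_zero.2 (h.row_ne_zero hirr y), hs⟩
  · exact mul_ne_zero (ENNReal.coe_ne_zero.2 h.pos.ne') hs0
  · simpa [op] using hB x
  · rw [mul_assoc, psi, ENNReal.mul_div_cancel hs0 hs]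
    exact_mod_cast h.upper x y

end Positivity

/-! ### The flagged chain restricted to plain or living states -/

lemma tsum_state {S : Type*} (F : State S → ℝ≥0∞) :
    ∑' t, F t = F (none, true) + F (none, false) +
      ∑' y, (F (some y, true) + F (some y, false)) := by
  rw [ENNReal.tsum_prod', ← (Equiv.optionEquivSumPUnit.{0} S).symm.tsum_eq,
    ENNReal.summable.tsum_sum ENNReal.summable]
  simp [tsum_fintype, add_comm]

/-- The flagged states that are alive and not produced by a regeneration. -/
def plain (S : Type*) : Set (State S) := {s | s.1 ≠ none ∧ s.2 = false}

/-- The flagged states that are alive. -/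
def alive (S : Type*) : Set (State S) := {s | s.1 ≠ none}

section Path

variable {S : Type*} {B : S → S → ℝ≥0} (hB : IsSubstochastic B) {v : S}
  {c₁ c₂ : ℝ≥0} (h : RowsComparable B v c₁ c₂)

lemma op_splitPMF_plain (f : State S → ℝ≥0∞) (x : S) (b : Bool) :
    op (fun a b => splitPMF hB h a b) ((plain S).indicator f) (some x, b) =
      op (residual B v c₁) (fun y => f (some y, false)) x := by
  rw [op, tsum_state]
  simp only [splitPMF, op]
  simp [plain, DFunLike.coe, splitStep, residual]

lemma op_splitPMF_alive (u : S → ℝ≥0∞) (x : S) (b : Bool) :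
    op (fun a b => splitPMF hB h a b) ((alive S).indicator fun s => s.1.elim 0 u) (some x, b) =
      op (fun x y => (B x y : ℝ≥0∞)) u x := by
  rw [op, tsum_state]
  simp only [splitPMF, op]
  simp only [DFunLike.coe]
  simp only [alive, Set.indicator, splitStep, Set.mem_ofPred_eq, ne_eq, not_true_eq_false,
    reduceCtorEq, not_false_eq_true, if_true, if_false, Option.elim, mul_zero, zero_add]
  refine tsum_congr fun y => ?_
  rw [← add_mul, add_comm]
  exact congrArg (· * u y) (h.residual_add hB x y)

open Classical in
lemma op_splitPMF_regen (hψ : pair (psi B v) 1 = 1) (x : S) (b : Bool) :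
    op (fun a b => splitPMF hB h a b) (fun s => if s.1 ≠ none ∧ s.2 = true then 1 else 0)
      (some x, b) = delta B v c₁ := by
  rw [op, tsum_state]
  simp only [splitPMF]
  simp only [DFunLike.coe]
  simp only [splitStep, ne_eq, not_true_eq_false, reduceCtorEq, not_false_eq_true, if_true,
    if_false, and_true, and_false, mul_zero, zero_add, mul_one, add_zero]
  rw [ENNReal.tsum_mul_left, ← pair_one, hψ, mul_one]

variable [Countable S]

lemma pathLaw_ae_zero (x : S) : ∀ᵐ ω ∂pathLaw hB h x, ω 0 = (some x, false) :=
  chainLaw_ae_zero _ _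

instance (x : S) : IsProbabilityMeasure (pathLaw hB h x) := by
  unfold pathLaw
  infer_instance

lemma lintegral_pathLaw_plain (x : S) (n : ℕ) (f : State S → ℝ≥0∞) :
    ∫⁻ ω, (stay (plain S) n).indicator (fun ω => f (ω n)) ω ∂pathLaw hB h x =
      (op (residual B v c₁))^[n] (fun y => f (some y, false)) x := by
  rw [pathLaw, lintegral_chainLaw_stay, Set.indicator_of_mem (by simp [plain])]
  induction n generalizing f with
  | zero => rfl
  | succ n ih =>
    rw [Function.iterate_succ_apply, Function.iterate_succ_apply, ih]
    simp only [op_splitPMF_plain]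

lemma lintegral_pathLaw_alive (x : S) (n : ℕ) (u : S → ℝ≥0∞) :
    ∫⁻ ω, (stay (alive S) n).indicator (fun ω => (ω n).1.elim 0 u) ω ∂pathLaw hB h x =
      (op fun x y => (B x y : ℝ≥0∞))^[n] u x := by
  refine (lintegral_chainLaw_stay (splitPMF hB h) (some x, false) (alive S) n
    fun s => s.1.elim 0 u).trans ?_
  rw [Set.indicator_of_mem (by simp [alive])]
  -- Only values at living states matter, and there every iterate is independent of the flag; the
  -- value at `Δ` is left free so that the induction closes.
  have key : ∀ (n : ℕ) (f : State S → ℝ≥0∞), (∀ y b, f (some y, b) = u y) → ∀ x b,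
      (fun f => op (fun a b => splitPMF hB h a b) ((alive S).indicator f))^[n] f (some x, b) =
        (op fun x y => (B x y : ℝ≥0∞))^[n] u x := by
    intro n
    induction n with
    | zero => exact fun f hf x b => hf x b
    | succ n ih =>
      intro f hf x b
      rw [Function.iterate_succ_apply', Function.iterate_succ_apply',
        ← op_splitPMF_alive hB h _ x b]
      congr 1
      ext s
      rcases s with ⟨_ | y, b'⟩
      · simp [alive]
      · rw [Set.indicator_of_mem (by simp [alive]), Set.indicator_of_mem (by simp [alive])]
        exact ih f hf y b'
  exact key n _ (fun y b => rfl) x false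

end Path

/-! ### The random times -/

lemma coe_lt_iInf_iff (P : ℕ → Prop) (n : ℕ) :
    (n : ℕ∞) < ⨅ (k : ℕ) (_ : P k), (k : ℕ∞) ↔ ∀ k ≤ n, ¬ P k := by
  constructor
  · intro hlt k hk hP
    have : (⨅ (k : ℕ) (_ : P k), (k : ℕ∞)) ≤ k := iInf₂_le k hP
    exact absurd (hlt.trans_le this) (not_lt.2 (by exact_mod_cast hk))
  · intro hall
    have : ((n + 1 : ℕ) : ℕ∞) ≤ ⨅ (k : ℕ) (_ : P k), (k : ℕ∞) := by
      refine le_iInf₂ fun k hk => ?_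
      have : n < k := by
        by_contra hkn
        exact hall k (not_lt.1 hkn) hk
      exact_mod_cast this
    exact lt_of_lt_of_le (by exact_mod_cast n.lt_succ_self) this

lemma coe_lt_hitT {S : Type*} {ω : ℕ → State S} {n : ℕ} :
    (n : ℕ∞) < hitT ω ↔ ∀ k ≤ n, (ω k).1 ≠ none :=
  coe_lt_iInf_iff _ n

lemma coe_lt_regenTau {S : Type*} {ω : ℕ → State S} {n : ℕ} :
    (n : ℕ∞) < regenTau ω ↔ ∀ k ≤ n, ¬ (1 ≤ k ∧ (ω k).2 = true) :=
  coe_lt_iInf_iff _ n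

/-- The initial flag must be false because `regenTau` ignores time `0`, whereas `stay` tests it. -/
lemma mem_stay_plain {S : Type*} {ω : ℕ → State S} (h0 : (ω 0).2 = false) {n : ℕ} :
    ω ∈ stay (plain S) n ↔ (n : ℕ∞) < regenTau ω ∧ (n : ℕ∞) < hitT ω := by
  rw [coe_lt_hitT, coe_lt_regenTau]
  constructor
  · intro hω
    refine ⟨fun k hk hk' => ?_, fun k hk => (hω k hk).1⟩
    have := (hω k hk).2
    rw [hk'.2] at this
    cases this
  · rintro ⟨h1, h2⟩ k hk
    refine ⟨h2 k hk, ?_⟩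
    rcases Nat.eq_zero_or_pos k with rfl | hpos
    · exact h0
    · have := h1 k hk
      cases hb : (ω k).2
      · rfl
      · exact absurd ⟨hpos, hb⟩ this

lemma expTime_coe (γ : ℝ) (n : ℕ) : expTime γ (n : ℕ∞) = ENNReal.ofReal (Real.exp γ) ^ n := by
  have : ((γ : EReal) * (((n : ℕ∞) : ℝ≥0∞) : EReal)) = ((n * γ : ℝ) : EReal) := by
    rw [mul_comm (n : ℝ), EReal.coe_mul]
    congr 1
  rw [expTime, this, EReal.exp_coe, ← ENNReal.ofReal_pow (Real.exp_pos γ).le, Real.exp_nat_mul]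

open Classical in
-- For finite positive `N` the single term `n = N - 1` suffices. For infinite `N` the terms are at
-- least one, so the series diverges. The bound reduces an exponential moment to tail probabilities.
lemma expTime_le {γ : ℝ} (hγ : 0 ≤ γ) (N : ℕ∞) :
    expTime γ N ≤ 1 + ∑' n : ℕ, ENNReal.ofReal (Real.exp γ) ^ (n + 1) *
      (if (n : ℕ∞) < N then 1 else 0) := by
  have h1 : 1 ≤ ENNReal.ofReal (Real.exp γ) := by
    rw [← ENNReal.ofReal_one]
    exact ENNReal.ofReal_le_ofReal (Real.one_le_exp hγ)
  induction N using ENat.recTopCoe with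
  | top =>
    have : ∑' n : ℕ, ENNReal.ofReal (Real.exp γ) ^ (n + 1) *
        (if (n : ℕ∞) < ⊤ then 1 else 0) = ∞ := by
      rw [eq_top_iff, ← ENNReal.tsum_const_eq_top_of_ne_zero (α := ℕ) one_ne_zero]
      refine ENNReal.tsum_le_tsum fun n => ?_
      simpa using one_le_pow₀ h1
    rw [this]
    simp
  | coe m =>
    rcases m with _ | n
    · rw [expTime_coe]
      simp
    · rw [expTime_coe]
      refine le_trans ?_ le_add_self
      refine le_trans ?_ (ENNReal.le_tsum n)
      rw [if_pos (by exact_mod_cast n.lt_succ_self), mul_one]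

lemma pow_le_expTime {γ : ℝ} (hγ : 0 < γ) {n : ℕ} {N : ℕ∞} (hn : (n : ℕ∞) < N) :
    ENNReal.ofReal (Real.exp γ) ^ n ≤ expTime γ N := by
  have h1 : 1 ≤ ENNReal.ofReal (Real.exp γ) := by
    rw [← ENNReal.ofReal_one]
    exact ENNReal.ofReal_le_ofReal (Real.one_le_exp hγ.le)
  induction N using ENat.recTopCoe with
  | top =>
    have : expTime γ ⊤ = ∞ := by
      simp [expTime, EReal.coe_mul_top_of_pos hγ]
    rw [this]
    exact le_top
  | coe m =>
    rw [expTime_coe]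
    exact pow_le_pow_right₀ h1 (by exact_mod_cast hn.le)

open Classical in
-- The events `{τ = n + 1 < T}` are disjoint, so at most one summand is non-zero: a plain path up to
-- `n`, followed by a regeneration.
lemma regenWeight_eq {S : Type*} (θ : ℝ) {ω : ℕ → State S} (h0 : (ω 0).2 = false) :
    regenWeight θ ω = ∑' n : ℕ, ENNReal.ofReal (Real.exp θ) ^ (n + 1) *
      (stay (plain S) n).indicator
        (fun ω => if (ω (n + 1)).1 ≠ none ∧ (ω (n + 1)).2 = true then 1 else 0) ω := by
  have hlt : ∀ n, ω ∈ stay (plain S) n → (ω (n + 1)).1 ≠ none → ((n + 1 : ℕ) : ℕ∞) < hitT ω := by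
    intro n hst hnone
    rw [coe_lt_hitT]
    intro k hk
    rcases Nat.lt_or_eq_of_le hk with hk | rfl
    · exact (hst k (by omega)).1
    · exact hnone
  have hle : ∀ n, (ω (n + 1)).2 = true → regenTau ω ≤ ((n + 1 : ℕ) : ℕ∞) := by
    intro n hf
    exact iInf₂_le (n + 1) ⟨by omega, hf⟩
  by_cases hτ : regenTau ω < hitT ω
  · rw [regenWeight, if_pos hτ]
    obtain ⟨m, hm⟩ := ENat.ne_top_iff_exists.1 (hτ.trans_le le_top).ne
    rcases m with _ | n
    · have : ((0 : ℕ) : ℕ∞) < regenTau ω := coe_lt_regenTau.2 (by omega)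
      rw [← hm] at this
      exact absurd this (lt_irrefl _)
    · have hst : ω ∈ stay (plain S) n := by
        rw [mem_stay_plain h0]
        have : (n : ℕ∞) < regenTau ω := by
          rw [← hm]
          exact_mod_cast n.lt_succ_self
        exact ⟨this, this.trans hτ⟩
      have hnone : (ω (n + 1)).1 ≠ none := by
        rw [← hm] at hτ
        exact coe_lt_hitT.1 hτ _ le_rfl
      have hflag : (ω (n + 1)).2 = true := by
        by_contra hf
        have : ((n + 1 : ℕ) : ℕ∞) < regenTau ω := by
          rw [coe_lt_regenTau]
          rintro k hk ⟨hk1, hkf⟩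
          rcases Nat.lt_or_eq_of_le hk with hk | rfl
          · have := (hst k (by omega)).2
            rw [hkf] at this
            cases this
          · exact hf hkf
        rw [← hm] at this
        exact lt_irrefl _ this
      rw [tsum_eq_single n]
      · rw [Set.indicator_of_mem hst, if_pos ⟨hnone, hflag⟩, mul_one, ← hm, expTime_coe]
      · intro k hk
        by_cases hstk : ω ∈ stay (plain S) k
        · rw [Set.indicator_of_mem hstk, if_neg, mul_zero]
          rintro ⟨-, hkf⟩
          have h1 := hle k hkf
          have h2 := ((mem_stay_plain h0).1 hstk).1
          rw [← hm] at h1 h2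
          have h1' : n + 1 ≤ k + 1 := by exact_mod_cast h1
          have h2' : k < n + 1 := by exact_mod_cast h2
          omega
        · rw [Set.indicator_of_notMem hstk, mul_zero]
  · rw [regenWeight, if_neg hτ, eq_comm, ENNReal.tsum_eq_zero]
    intro n
    by_cases hst : ω ∈ stay (plain S) n
    · rw [Set.indicator_of_mem hst, if_neg, mul_zero]
      rintro ⟨h1, h2⟩
      exact hτ ((hle n h2).trans_lt (hlt n hst h1))
    · rw [Set.indicator_of_notMem hst, mul_zero]

open Classical in
lemma cycleWeight_eq {S : Type*} (θ : ℝ) (y : S) {ω : ℕ → State S} (h0 : (ω 0).2 = false) :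
    cycleWeight θ y ω = ∑' j : ℕ, ENNReal.ofReal (Real.exp θ) ^ j *
      (stay (plain S) j).indicator (fun ω => (ω j).1.elim 0 (point y)) ω := by
  refine tsum_congr fun j => ?_
  by_cases hst : ω ∈ stay (plain S) j
  · have := (mem_stay_plain h0).1 hst
    rw [Set.indicator_of_mem hst]
    rcases hω : (ω j).1 with _ | w
    · simp
    · by_cases hw : w = y
      · simp [this.1, this.2, hw, point, expTime_coe]
      · simp [hw, point]
  · rw [Set.indicator_of_notMem hst, mul_zero, if_neg]
    rw [mem_stay_plain h0] at hst
    tauto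

/-! ### Expectations as matrix series -/

section Expectation

variable {S : Type*} [Countable S] {B : S → S → ℝ≥0} (hB : IsSubstochastic B) {v : S}
  {c₁ c₂ : ℝ≥0} (h : RowsComparable B v c₁ c₂)

/-- From any living state the next step regenerates with probability `δ`, so `P_x(τ = n + 1 < T) = δ
C^n 1(x)`. -/
lemma uStar_eq (hψ : pair (psi B v) 1 = 1) (θ : ℝ) :
    uStar hB h θ =
      firstRegen (residual B v c₁) (delta B v c₁) (ENNReal.ofReal (Real.exp θ)) := by
  classical
  ext x
  have hae := (pathLaw_ae_zero hB h x).mono fun ω hω =>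
    regenWeight_eq θ (ω := ω) (by rw [hω])
  have hmeas : ∀ n : ℕ, Measurable ((stay (plain S) n).indicator fun ω : ℕ → State S =>
      if (ω (n + 1)).1 ≠ none ∧ (ω (n + 1)).2 = true then (1 : ℝ≥0∞) else 0) := fun n =>
    ((Measurable.of_discrete (f := fun s : State S =>
      if s.1 ≠ none ∧ s.2 = true then (1 : ℝ≥0∞) else 0)).comp
        (measurable_pi_apply (n + 1))).indicator (measurableSet_stay _ n)
  rw [uStar, lintegral_congr_ae hae, lintegral_tsum fun n => ((hmeas n).const_mul _).aemeasurable]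
  refine tsum_congr fun n => ?_
  rw [lintegral_const_mul _ (hmeas n), mul_assoc]
  congr 1
  rw [pathLaw, lintegral_chainLaw_succ (splitPMF hB h) (some x, false) (plain S) n
    (fun s : State S => if s.1 ≠ none ∧ s.2 = true then (1 : ℝ≥0∞) else 0)]
  refine (lintegral_pathLaw_plain hB h x n _).trans ?_
  simp only [op_splitPMF_regen hB h hψ]
  have := congrFun (iterate_op_smul (residual B v c₁) n (delta B v c₁) 1) x
  rw [Pi.smul_apply, smul_eq_mul] at this
  rw [← this]
  refine congrFun (congrArg _ ?_) x
  ext y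
  simp

lemma etaStar_eq (θ : ℝ) :
    etaStar hB h θ =
      occupation (residual B v c₁) (psi B v) (ENNReal.ofReal (Real.exp θ)) := by
  classical
  ext y
  have hx : ∀ x, ∫⁻ ω, cycleWeight θ y ω ∂pathLaw hB h x =
      ∑' j : ℕ, (ENNReal.ofReal (Real.exp θ) ^ j •
        (op (residual B v c₁))^[j] (point y)) x := by
    intro x
    have hae := (pathLaw_ae_zero hB h x).mono fun ω hω =>
      cycleWeight_eq θ y (ω := ω) (by rw [hω])
    have hmeas : ∀ n : ℕ, Measurable ((stay (plain S) n).indicator fun ω : ℕ → State S =>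
        (ω n).1.elim 0 (point y)) := fun n =>
      ((Measurable.of_discrete (f := fun s : State S => s.1.elim 0 (point y))).comp
          (measurable_pi_apply n)).indicator (measurableSet_stay _ n)
    rw [lintegral_congr_ae hae, lintegral_tsum fun n => ((hmeas n).const_mul _).aemeasurable]
    refine tsum_congr fun n => ?_
    rw [lintegral_const_mul _ (hmeas n),
      lintegral_pathLaw_plain hB h x n (fun s => s.1.elim 0 (point y))]
    rfl
  rw [etaStar, expPsi]
  simp only [hx]
  refine (pair_tsum (psi B v) _).trans ?_
  simp only [pair_smul]
  rfl

lemma isRoot_iff (hψ : pair (psi B v) 1 = 1) (θ : ℝ) :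
    IsRoot hB h θ ↔ pair (psi B v)
      (firstRegen (residual B v c₁) (delta B v c₁) (ENNReal.ofReal (Real.exp θ))) = 1 := by
  rw [← uStar_eq hB h hψ]
  rfl

/-- Here `P_x(T ∧ τ > n) = C^n 1(x)`, so the tail series is that of `firstRegen` without the factor
`δ`, which is cancelled at the end. -/
lemma expPsi_min_lt_top (hψ : pair (psi B v) 1 = 1) (hδ : delta B v c₁ ≠ 0) {γ : ℝ} (hγ : 0 ≤ γ)
    (hfin : pair (psi B v)
      (firstRegen (residual B v c₁) (delta B v c₁) (ENNReal.ofReal (Real.exp γ))) < ∞) :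
    expPsi hB h (fun ω => expTime γ (min (hitT ω) (regenTau ω))) < ∞ := by
  classical
  set z := ENNReal.ofReal (Real.exp γ)
  have hx : ∀ x, ∫⁻ ω, expTime γ (min (hitT ω) (regenTau ω)) ∂pathLaw hB h x ≤
      ((1 : S → ℝ≥0∞) + fun x => ∑' n : ℕ,
        (z ^ (n + 1) • (op (residual B v c₁))^[n] 1) x) x := by
    intro x
    have hae : ∀ᵐ ω ∂pathLaw hB h x, expTime γ (min (hitT ω) (regenTau ω)) ≤
        1 + ∑' n : ℕ, z ^ (n + 1) * (stay (plain S) n).indicator (fun _ => 1) ω := by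
      filter_upwards [pathLaw_ae_zero hB h x] with ω hω
      refine (expTime_le hγ _).trans_eq ?_
      congr 1
      refine tsum_congr fun n => ?_
      congr 1
      have := mem_stay_plain (ω := ω) (n := n) (by rw [hω])
      simp only [Set.indicator, this, lt_min_iff, and_comm]
    have hmeas : ∀ n : ℕ, Measurable ((stay (plain S) n).indicator fun _ : ℕ → State S =>
        (1 : ℝ≥0∞)) := fun n => measurable_const.indicator (measurableSet_stay _ n)
    refine (lintegral_mono_ae hae).trans_eq ?_
    rw [lintegral_add_left measurable_const, lintegral_one, measure_univ,
      lintegral_tsum fun n => ((hmeas n).const_mul _).aemeasurable, Pi.add_apply, Pi.one_apply]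
    congr 1
    refine tsum_congr fun n => ?_
    rw [lintegral_const_mul _ (hmeas n)]
    congr 1
    exact lintegral_pathLaw_plain hB h x n fun _ => 1
  refine (pair_mono (psi B v) hx).trans_lt ?_
  rw [pair_add, hψ, pair_tsum]
  simp only [pair_smul]
  refine ENNReal.add_lt_top.2 ⟨ENNReal.one_lt_top, ?_⟩
  rw [pair_firstRegen] at hfin
  simp only [mul_left_comm _ (delta B v c₁)] at hfin
  rw [ENNReal.tsum_mul_left] at hfin
  exact ENNReal.lt_top_of_mul_ne_top_right hfin.ne hδ

/-- On `{T > n}`, an event of probability `ψB^n1` under `P_ψ`, the integrand is at least `e^(γn)`.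
-/
lemma pow_mul_le_expPsi_hitT {γ : ℝ} (hγ : 0 < γ) (n : ℕ) :
    ENNReal.ofReal (Real.exp γ) ^ n *
        pair (psi B v) ((op fun x y => (B x y : ℝ≥0∞))^[n] 1) ≤
      expPsi hB h (fun ω => expTime γ (hitT ω)) := by
  rw [← pair_smul]
  refine pair_mono (psi B v) fun x => ?_
  rw [Pi.smul_apply, smul_eq_mul, ← lintegral_pathLaw_alive hB h x n 1]
  have hmeas : Measurable ((stay (alive S) n).indicator fun ω : ℕ → State S =>
      (ω n).1.elim 0 (1 : S → ℝ≥0∞)) :=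
    ((Measurable.of_discrete (f := fun s : State S => s.1.elim 0 (1 : S → ℝ≥0∞))).comp
      (measurable_pi_apply n)).indicator (measurableSet_stay _ n)
  rw [← lintegral_const_mul _ hmeas]
  refine lintegral_mono fun ω => ?_
  by_cases hst : ω ∈ stay (alive S) n
  · have h1 : (ω n).1.elim 0 (1 : S → ℝ≥0∞) ≤ 1 := by
      rcases (ω n).1 with _ | y <;> simp
    simp only [Set.indicator_of_mem hst]
    exact (mul_le_of_le_one_right' h1).trans (pow_le_expTime hγ (coe_lt_hitT.2 hst))
  · simp [Set.indicator_of_notMem hst]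

end Expectation

/-! ### Comparison of the root with the two abscissas -/

lemma IsSplit.le_mul_pair_iterate {S : Type*} {B C : S → S → ℝ≥0∞} {ψ : S → ℝ≥0∞}
    {δ κ z K : ℝ≥0∞} (h : IsSplit B C ψ δ κ) (hroot : pair ψ (firstRegen C δ z) = 1)
    (hK : ∀ x, firstRegen C δ z x ≤ K) (n : ℕ) :
    z * δ ≤ K * (z ^ n * pair ψ ((op B)^[n] 1)) := by
  have hfix : z ^ n • (op B)^[n] (firstRegen C δ z) = firstRegen C δ z := by
    rw [← iterate_smul_op]
    refine Function.iterate_fixed ?_ n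
    simpa [h.op_firstRegen hroot] using iterate_smul_op B z 1 (firstRegen C δ z)
  -- The fixed vector of `zB` lies between `zδ` and `K`, so the mass `z^n ψB^n1` cannot decay.
  calc z * δ ≤ pair ψ (firstRegen C δ z) := h.le_pair_of_le fun x => le_firstRegen C δ z x
    _ = z ^ n * pair ψ ((op B)^[n] (firstRegen C δ z)) := by rw [← pair_smul, hfix]
    _ ≤ z ^ n * pair ψ ((op B)^[n] (K • 1)) := by
      gcongr
      exact pair_mono _ (iterate_op_mono B n fun x => by simpa using hK x)
    _ = K * (z ^ n * pair ψ ((op B)^[n] 1)) := by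
      rw [iterate_op_smul, pair_smul]
      ring

section Main

variable {S : Type*} [Countable S] {B : S → S → ℝ≥0} (hB : IsSubstochastic B) {v : S}
  {c₁ c₂ : ℝ≥0} (h : RowsComparable B v c₁ c₂)

lemma theta1_le (hirr : IsIrreducible B) {θ : ℝ} (hθ : 0 ≤ θ) (hroot : IsRoot hB h θ) :
    theta1 hB h ≤ θ := by
  have hs := h.isSplit hB hirr
  rw [isRoot_iff hB h hs.mass] at hroot
  refine iSup₂_le fun γ hγ => ?_
  by_contra hlt
  have hlt : θ < γ := by exact_mod_cast not_le.1 hlt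
  set z := ENNReal.ofReal (Real.exp θ) with hzdef
  have hz0 : z ≠ 0 := (ENNReal.ofReal_pos.2 (Real.exp_pos θ)).ne'
  have hz : z ≠ ∞ := ENNReal.ofReal_ne_top
  obtain ⟨K, hK, hUK⟩ := hs.firstRegen_bounded hz hroot.le
  -- For `γ > θ` the surplus factor `w > 1` makes the lower bounds for `E_ψ e^(γT)` grow like `w^n`.
  set w := ENNReal.ofReal (Real.exp (γ - θ)) with hw
  have hw1 : 1 < w := by
    rw [hw, ← ENNReal.ofReal_one]
    exact (ENNReal.ofReal_lt_ofReal_iff (Real.exp_pos _)).2 (Real.one_lt_exp_iff.2 (by linarith))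
  have hwz : ENNReal.ofReal (Real.exp γ) = w * z := by
    rw [hw, hzdef, ← ENNReal.ofReal_mul (Real.exp_pos _).le, ← Real.exp_add, sub_add_cancel]
  have hbound : ∀ n : ℕ, w ^ n * (z * delta B v c₁) ≤
      K * expPsi hB h (fun ω => expTime γ (hitT ω)) := by
    intro n
    calc w ^ n * (z * delta B v c₁)
        ≤ w ^ n * (K * (z ^ n * pair (psi B v) ((op fun x y => (B x y : ℝ≥0∞))^[n] 1))) :=
          mul_le_mul_right (hs.le_mul_pair_iterate hroot hUK n) _
      _ = K * ((w * z) ^ n * pair (psi B v) ((op fun x y => (B x y : ℝ≥0∞))^[n] 1)) := by ring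
      _ ≤ _ := by
          rw [← hwz]
          exact mul_le_mul_right (pow_mul_le_expPsi_hitT hB h (hθ.trans_lt hlt) n) _
  have hlim : Tendsto (fun n : ℕ => w ^ n * (z * delta B v c₁)) atTop (𝓝 ∞) := by
    have h1 : Tendsto (fun n : ℕ => w ^ n) atTop (𝓝 ∞) :=
      ENNReal.tendsto_pow_atTop_nhds_top_iff.2 hw1
    have h2 := ENNReal.Tendsto.mul_const (b := z * delta B v c₁) h1 (Or.inl ENNReal.top_ne_zero)
    rwa [ENNReal.top_mul (mul_ne_zero hz0 hs.delta_ne_zero)] at h2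
  have htop := le_of_tendsto' hlim hbound
  exact (ENNReal.mul_lt_top hK.lt_top hγ).ne (top_le_iff.1 htop)

lemma lt_theta2 (hirr : IsIrreducible B) {θ : ℝ} (hθ : 0 ≤ θ) (hroot : IsRoot hB h θ) :
    (θ : EReal) < theta2 hB h := by
  have hs := h.isSplit hB hirr
  rw [isRoot_iff hB h hs.mass] at hroot
  -- Convergence at `rz` with `r > 1` is convergence at the exponent `θ + log r`, strictly to the
  -- right of `θ`.
  obtain ⟨r, hr, hfin⟩ := hs.exists_extension
    (ENNReal.ofReal_pos.2 (Real.exp_pos θ)).ne' ENNReal.ofReal_ne_top hroot.le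
  have hr0 : (0 : ℝ) < r := by exact_mod_cast zero_lt_one.trans hr
  have hlog : 0 < Real.log r := Real.log_pos (by exact_mod_cast hr)
  have hz : (r : ℝ≥0∞) * ENNReal.ofReal (Real.exp θ) =
      ENNReal.ofReal (Real.exp (Real.log r + θ)) := by
    rw [Real.exp_add, Real.exp_log hr0, ENNReal.ofReal_mul hr0.le, ENNReal.ofReal_coe_nnreal]
  rw [hz] at hfin
  have hmem := expPsi_min_lt_top hB h hs.mass hs.delta_ne_zero (by positivity) hfin
  refine lt_of_lt_of_le ?_ (le_iSup₂ (f := fun (γ : ℝ) (_ : expPsi hB h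
    (fun ω => expTime γ (min (hitT ω) (regenTau ω))) < ∞) => (γ : EReal)) _ hmem)
  exact_mod_cast (by linarith : θ < Real.log r + θ)

lemma exists_isRoot (hirr : IsIrreducible B) : ∃ θ : ℝ, 0 ≤ θ ∧ IsRoot hB h θ := by
  have hs := h.isSplit hB hirr
  obtain ⟨t, ht, hroot⟩ := hs.exists_root
  have ht' : (1 : ℝ) ≤ t := by exact_mod_cast ht
  refine ⟨Real.log t, Real.log_nonneg ht', ?_⟩
  rwa [isRoot_iff hB h hs.mass, Real.exp_log (by linarith), ENNReal.ofReal_coe_nnreal]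

lemma lamStar_eq (θ : ℝ) : lamStar θ = (ENNReal.ofReal (Real.exp θ))⁻¹ := by
  rw [lamStar, Real.exp_neg, ENNReal.ofReal_inv_of_pos (Real.exp_pos θ)]

end Main

end PerronFrobenius

end

/-! ### Assembly of the theorem -/

theorem theorem5 {S : Type*} [Countable S] (B : S → S → ℝ≥0)
    (hB : PerronFrobenius.IsSubstochastic B) (hirr : PerronFrobenius.IsIrreducible B)
    (v : S) (c₁ c₂ : ℝ≥0) (h : PerronFrobenius.RowsComparable B v c₁ c₂) :
    -- strict inequality of the abscissas
    PerronFrobenius.theta1 hB h < PerronFrobenius.theta2 hB h ∧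
    -- a root exists
    (∃ θ : ℝ, 0 ≤ θ ∧ PerronFrobenius.IsRoot hB h θ) ∧
    -- the period is one
    (∀ w, PerronFrobenius.period B w = 1) ∧
    -- for every root, the eigenvectors and the limits
    ∀ θ : ℝ, PerronFrobenius.IsRoot hB h θ →
      (PerronFrobenius.IsPosColEigen B (PerronFrobenius.lamStar θ)
          (PerronFrobenius.uStar hB h θ) ∧
        ∀ u, PerronFrobenius.IsPosColEigen B (PerronFrobenius.lamStar θ) u →
          PerronFrobenius.IsPosMultiple u (PerronFrobenius.uStar hB h θ)) ∧
      (PerronFrobenius.IsPosRowEigen B (PerronFrobenius.lamStar θ)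
          (PerronFrobenius.etaStar hB h θ) ∧
        ∀ η, PerronFrobenius.IsPosRowEigen B (PerronFrobenius.lamStar θ) η →
          PerronFrobenius.IsPosMultiple η (PerronFrobenius.etaStar hB h θ)) ∧
      ∑' w, PerronFrobenius.etaStar hB h θ w * PerronFrobenius.uStar hB h θ w < ∞ ∧
      (∀ p : ℕ, (∀ w, PerronFrobenius.period B w = p) → ∀ x y,
        Tendsto
          (fun n : ℕ => (p : ℝ≥0∞)⁻¹ * ∑ j ∈ Finset.range p,
            (PerronFrobenius.lamStar θ)⁻¹ ^ (p * n + j) *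
              PerronFrobenius.matPow B (p * n + j) x y)
          atTop
          (𝓝 (PerronFrobenius.uStar hB h θ x * PerronFrobenius.etaStar hB h θ y /
            ∑' w, PerronFrobenius.etaStar hB h θ w * PerronFrobenius.uStar hB h θ w))) ∧
      (∀ x y,
        Tendsto
          (fun n : ℕ => PerronFrobenius.matPow B n x y /
            (PerronFrobenius.lamStar θ ^ n *
              (PerronFrobenius.uStar hB h θ x * PerronFrobenius.etaStar hB h θ y /
                ∑' w, PerronFrobenius.uStar hB h θ w * PerronFrobenius.etaStar hB h θ w)))
          atTop (𝓝 1)) := by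
  have hs := h.isSplit hB hirr
  have hper := h.period_eq_one hirr
  -- One non-negative root suffices to separate the abscissas; the remaining claims hold for any
  -- root and use no sign of `θ`.
  obtain ⟨θ₀, hθ₀, hroot₀⟩ := PerronFrobenius.exists_isRoot hB h hirr
  refine ⟨(PerronFrobenius.theta1_le hB h hirr hθ₀ hroot₀).trans_lt
      (PerronFrobenius.lt_theta2 hB h hirr hθ₀ hroot₀),
    ⟨θ₀, hθ₀, hroot₀⟩, hper, fun θ hroot => ?_⟩
  rw [PerronFrobenius.isRoot_iff hB h hs.mass] at hroot
  rw [PerronFrobenius.lamStar_eq, PerronFrobenius.uStar_eq hB h hs.mass,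
    PerronFrobenius.etaStar_eq hB h]
  set z := ENNReal.ofReal (Real.exp θ)
  have hz0 : z ≠ 0 := (ENNReal.ofReal_pos.2 (Real.exp_pos θ)).ne'
  have hz : z ≠ ∞ := ENNReal.ofReal_ne_top
  have hinv : ∀ a b : ℝ≥0∞, z * a = b ↔ a = z⁻¹ * b := by
    refine fun a b => ⟨fun hab => ?_, fun hab => ?_⟩
    · rw [← hab, ← mul_assoc, ENNReal.inv_mul_cancel hz0 hz, one_mul]
    · rw [hab, ← mul_assoc, ENNReal.mul_inv_cancel hz0 hz, one_mul]
  set U := PerronFrobenius.firstRegen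
    (PerronFrobenius.residual B v c₁) (PerronFrobenius.delta B v c₁) z
  set H := PerronFrobenius.occupation
    (PerronFrobenius.residual B v c₁) (PerronFrobenius.psi B v) z
  have hU0 : ∀ x, U x ≠ 0 := fun x =>
    ((pos_iff_ne_zero.2 (mul_ne_zero hz0 hs.delta_ne_zero)).trans_le
      (PerronFrobenius.le_firstRegen _ _ z x)).ne'
  have hU : ∀ x, U x ≠ ∞ := by
    obtain ⟨K, hK, hUK⟩ := hs.firstRegen_bounded hz hroot.le
    exact fun x => ne_top_of_le_ne_top hK (hUK x)
  have hH0 : ∀ y, H y ≠ 0 := fun y =>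
    ((pos_iff_ne_zero.2 (hs.psi_ne_zero y)).trans_le (PerronFrobenius.le_occupation _ _ z y)).ne'
  have hH : ∀ y, H y ≠ ∞ := hs.occupation_ne_top hz0 hroot
  have hm0 : ∑' w, H w * U w ≠ 0 := PerronFrobenius.IsSplit.pair_occupation_firstRegen_ne_zero hroot
  have hm : ∑' w, H w * U w ≠ ∞ := hs.pair_occupation_firstRegen_ne_top hz0 hz hroot
  have hlim : ∀ x y, Tendsto (fun n : ℕ => z ^ n * PerronFrobenius.matPow B n x y) atTop
      (𝓝 (U x * H y / ∑' w, H w * U w)) := by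
    intro x y
    simp only [PerronFrobenius.matPow_eq_iterate]
    exact hs.tendsto_iterate hz0 hz hroot x y
  refine ⟨⟨⟨fun x => ⟨pos_iff_ne_zero.2 (hU0 x), (hU x).lt_top⟩, fun x =>
      (hinv _ _).1 (congrFun (hs.op_firstRegen hroot) x)⟩, fun u hu => ?_⟩,
    ⟨⟨fun y => ⟨pos_iff_ne_zero.2 (hH0 y), (hH y).lt_top⟩, fun y =>
      (hinv _ _).1 (hs.occupation_mul hroot y)⟩, fun η hη => ?_⟩, hm.lt_top,
    fun p hp x y => ?_, fun x y => ?_⟩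
  · obtain ⟨ha, hau⟩ := hs.eq_smul_firstRegen hz0 hroot (fun x => (hu.1 x).2.ne)
      (funext fun x => (hinv _ _).2 (hu.2 x))
    lift PerronFrobenius.pair (PerronFrobenius.psi B v) u to ℝ≥0 using ha with a
    refine ⟨a, pos_iff_ne_zero.2 fun ha0 => (hu.1 v).1.ne' ?_, fun x => congrFun hau x⟩
    rw [hau, ha0]
    simp
  · obtain ⟨ha, haη⟩ := hs.eq_smul_occupation hz0 hroot (fun x => (hη.1 x).2.ne)
      (fun y => (hinv _ _).2 (hη.2 y))
    lift z * PerronFrobenius.delta B v c₁ * PerronFrobenius.pair η 1 to ℝ≥0 using ha with a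
    refine ⟨a, pos_iff_ne_zero.2 fun ha0 => (hη.1 v).1.ne' ?_, fun x => congrFun haη x⟩
    rw [haη, ha0]
    simp
  · obtain rfl : p = 1 := (hp v).symm.trans (hper v)
    simpa [inv_inv] using hlim x y
  · simp only [mul_comm (U _) (H _)] at *
    have hL0 : H y * U x / ∑' w, H w * U w ≠ 0 :=
      ENNReal.div_ne_zero.2 ⟨mul_ne_zero (hH0 y) (hU0 x), hm⟩
    have hL : H y * U x / ∑' w, H w * U w ≠ ∞ :=
      ENNReal.div_ne_top (ENNReal.mul_ne_top (hH y) (hU x)) hm0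
    have hdiv := ENNReal.Tendsto.div_const (hlim x y) (Or.inr hL0)
    rw [ENNReal.div_self hL0 hL] at hdiv
    refine hdiv.congr fun n => ?_
    generalize H y * U x / ∑' w, H w * U w = L at hL0 hL ⊢
    rw [div_eq_mul_inv, div_eq_mul_inv, ENNReal.mul_inv (Or.inr hL) (Or.inr hL0),
      ← ENNReal.inv_pow, inv_inv]
    ring
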